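/- Notation. $(a)_n=a(a+1)\cdots(a+n-1)$; for $y\in\mathbb{R}^d$ put $|y|=y_1+\cdots+y_d$, $|y^{j}|=y_j+\cdots+y_d$ (so $|y^{d+1}|=0$) and $|Y_j|=y_1+\cdots+y_j$ (empty for $j\le 0$). With $e_1,\dots,e_d$ the standard basis, $\triangle_i f(x)=f(x+e_i)-f(x)$ and $\nabla_i f(x)=f(x)-f(x-e_i)$. Let $$R_n(x;\alpha_1,\alpha_2,\alpha_3)={}_3F_2\left(\begin{matrix}-n,\ n-\alpha_3+\alpha_1+\alpha_2+1,\ -x\\ \alpha_1+1,\ \alpha_2+1\end{matrix};1\right).$$ Theorem 5.2. Let $d\ge 1$, let $\sigma\in\mathbb{R}^d$ with $\sigma_i>-1$ for all $i$, and let $\beta,\gamma\in\mathbb{R}$ be such that the weight $$W(x)=\prod_{i=1}^d\frac{(\sigma_i+1)_{x_i}}{x_i!}\,\frac{(\beta+1)_{|x|}}{(\gamma+1)_{|x|}}$$ is (defined and) positive for every $x\in\mathbb{N}_0^d$. Put $\lambda_n=n(-n+\gamma-\beta-|\sigma|-d)$ and $$D=-\sum_{1\le i,j\le d}x_j\,[\sigma_i+1+x_i+\delta_{i,j}(\gamma-|\sigma|-d)]\,\triangle_i\nabla_j+\sum_{i=1}^d\,[x_i(\gamma-\beta-|\sigma|-d-1)-(1+\beta)(1+\sigma_i)]\,\triangle_i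 .$$ For $\nu\in\mathbb{N}_0^d$ let $$R_\nu(x;\sigma,\beta,\gamma)=\prod_{j=1}^d(\alpha_{2,j}+1)_{\nu_j}\,R_{\nu_j}(x_j;\sigma_j,\alpha_{2,j},\alpha_{3,j}),$$ $$\alpha_{2,j}=\beta+|\nu^{j+1}|+|X_{j-1}|,\qquad \alpha_{3,j}=\gamma-|\nu^{j+1}|-|\sigma^{j+1}|-(d-j)+|X_{j-1}| .$$ The differences $\alpha_{3,j}-\alpha_{2,j}=\gamma-\beta-2|\nu^{j+1}|-|\sigma^{j+1}|-(d-j)$ do not depend on $x$; this expression defines them for $0\le j\le d$. (a) If $2|\nu|<\gamma-|\sigma|-\beta-d-1$, then $R_\nu$ is (given by) a polynomial in $x$ of total degree $|\nu|$: there is a polynomial of total degree $|\nu|$ that agrees with the formula above at every $x\in\mathbb{R}^d$ where no $(\alpha_{2,j}+1)_{\nu_j}$ vanishes, in particular on $\mathbb{N}_0^d$, where none of these factors vanishes. As a polynomial it satisfies, on all of $\mathbb{R}^d$, $$D R_\nu=\lambda_{|\nu|}R_\nu .$$ (b) If $\nu,\mu\in\mathbb{N}_0^d$ and both $2|\nu|$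 and $2|\mu|$ are less than $\gamma-|\sigma|-\beta-d-1$, then, with an absolutely convergent series, $$\sum_{x\in\mathbb{N}_0^d}R_\nu(x;\sigma,\beta,\gamma)\,R_\mu(x;\sigma,\beta,\gamma)\,W(x)=A_\nu\,\delta_{\nu,\mu},$$ where $$A_\nu=\frac{(1+\beta)_{|\nu|}\,\Gamma(1+\gamma)\,\Gamma(\gamma-\beta-|\sigma|-2|\nu|-d)}{\Gamma(\gamma-|\sigma|-|\nu|+1-d)\,\Gamma(\gamma-\beta)}\prod_{j=1}^d\frac{\nu_j!\,(\alpha_{3,j}-\alpha_{2,j}-\nu_j)_{\nu_j}\,(\alpha_{3,j-1}-\alpha_{2,j-1}+1)_{\nu_j}}{(1+\sigma_j)_{\nu_j}} .$$ -/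

import Mathlib

noncomputable section

open Finset

/-- The Pochhammer symbol `(a)_n = a (a+1) ⋯ (a+n-1)`. -/
def poch (a : ℝ) (n : ℕ) : ℝ := (ascPochhammer ℝ n).eval a

/-- The polynomial `R_n(x; α₁, α₂, α₃) = ₃F₂(-n, n - α₃ + α₁ + α₂ + 1, -x; α₁ + 1, α₂ + 1; 1)`.
The hypergeometric series terminates at `k = n` because `(-n)_k = 0` for `k > n`. -/
def oneVarR (n : ℕ) (α₁ α₂ α₃ x : ℝ) : ℝ :=
  ∑ k ∈ range (n + 1),
    poch (-(n : ℝ)) k * poch ((n : ℝ) - α₃ + α₁ + α₂ + 1) k * poch (-x) k /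
      (poch (α₁ + 1) k * poch (α₂ + 1) k * (k.factorial : ℝ))

/-- `|y| = y₁ + ⋯ + y_d`. -/
def total {d : ℕ} (y : Fin d → ℝ) : ℝ := ∑ i, y i

/-- `|y^j| = y_j + y_{j+1} + ⋯ + y_d`, coordinates numbered from `1` to `d`
(the coordinate with number `i + 1` is `y i` for `i : Fin d`); it is `0` for `j = d + 1`. -/
def tailSum {d : ℕ} (y : Fin d → ℝ) (j : ℕ) : ℝ := ∑ i with j ≤ i.val + 1, y i

/-- `|Y_j| = y₁ + ⋯ + y_j`, coordinates numbered from `1` to `d`; it is `0` for `j = 0`. -/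
def headSum {d : ℕ} (y : Fin d → ℝ) (j : ℕ) : ℝ := ∑ i with i.val + 1 ≤ j, y i

/-- A multi-index, read as a real vector. -/
def toReal {d : ℕ} (ν : Fin d → ℕ) : Fin d → ℝ := fun i => (ν i : ℝ)

/-- `α_{2,j} = β + |ν^{j+1}| + |X_{j-1}|`. -/
def alpha2 {d : ℕ} (β : ℝ) (ν : Fin d → ℕ) (x : Fin d → ℝ) (j : ℕ) : ℝ :=
  β + tailSum (toReal ν) (j + 1) + headSum x (j - 1)

/-- `α_{3,j} = γ - |ν^{j+1}| - |σ^{j+1}| - (d - j) + |X_{j-1}|`. -/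
def alpha3 {d : ℕ} (σ : Fin d → ℝ) (γ : ℝ) (ν : Fin d → ℕ) (x : Fin d → ℝ) (j : ℕ) : ℝ :=
  γ - tailSum (toReal ν) (j + 1) - tailSum σ (j + 1) - ((d : ℝ) - (j : ℝ)) + headSum x (j - 1)

/-- `α_{3,j} - α_{2,j}`, which does not depend on `x`; used for `0 ≤ j ≤ d`. -/
def alphaGap {d : ℕ} (σ : Fin d → ℝ) (β γ : ℝ) (ν : Fin d → ℕ) (j : ℕ) : ℝ :=
  γ - β - 2 * tailSum (toReal ν) (j + 1) - tailSum σ (j + 1) - ((d : ℝ) - (j : ℝ))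

theorem alpha3_sub_alpha2 {d : ℕ} (σ : Fin d → ℝ) (β γ : ℝ) (ν : Fin d → ℕ) (x : Fin d → ℝ)
    (j : ℕ) : alpha3 σ γ ν x j - alpha2 β ν x j = alphaGap σ β γ ν j := by
  unfold alpha3 alpha2 alphaGap
  ring

/-- `R_ν(x; σ, β, γ) = ∏_{j=1}^d (α_{2,j} + 1)_{ν_j} R_{ν_j}(x_j; σ_j, α_{2,j}, α_{3,j})`. -/
def multiR {d : ℕ} (σ : Fin d → ℝ) (β γ : ℝ) (ν : Fin d → ℕ) (x : Fin d → ℝ) : ℝ :=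
  ∏ i : Fin d, poch (alpha2 β ν x (i.val + 1) + 1) (ν i) *
    oneVarR (ν i) (σ i) (alpha2 β ν x (i.val + 1)) (alpha3 σ γ ν x (i.val + 1)) (x i)

/-- The weight `W(x) = ∏_i (σ_i + 1)_{x_i} / x_i! · (β + 1)_{|x|} / (γ + 1)_{|x|}` on `ℕ₀^d`. -/
def weight {d : ℕ} (σ : Fin d → ℝ) (β γ : ℝ) (x : Fin d → ℕ) : ℝ :=
  (∏ i, poch (σ i + 1) (x i) / ((x i).factorial : ℝ)) *
    (poch (β + 1) (∑ i, x i) / poch (γ + 1) (∑ i, x i))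

/-- The forward difference `△_i f (x) = f (x + e_i) - f x`. -/
def forwardDiff {d : ℕ} (i : Fin d) (f : (Fin d → ℝ) → ℝ) : (Fin d → ℝ) → ℝ :=
  fun x => f (x + Pi.single i 1) - f x

/-- The backward difference `∇_i f (x) = f x - f (x - e_i)`. -/
def backwardDiff {d : ℕ} (i : Fin d) (f : (Fin d → ℝ) → ℝ) : (Fin d → ℝ) → ℝ :=
  fun x => f x - f (x - Pi.single i 1)

/-- The second order partial difference operator
`D = - ∑_{i,j} x_j [σ_i + 1 + x_i + δ_{ij} (γ - |σ| - d)] △_i ∇_j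
  + ∑_i [x_i (γ - β - |σ| - d - 1) - (1 + β) (1 + σ_i)] △_i`. -/
def diffOp {d : ℕ} (σ : Fin d → ℝ) (β γ : ℝ) (f : (Fin d → ℝ) → ℝ) : (Fin d → ℝ) → ℝ :=
  fun x =>
    -(∑ i, ∑ j, x j * (σ i + 1 + x i + if i = j then γ - total σ - d else 0) *
        forwardDiff i (backwardDiff j f) x)
    + ∑ i, (x i * (γ - β - total σ - d - 1) - (1 + β) * (1 + σ i)) * forwardDiff i f x

/-- The eigenvalue `λ_n = n (-n + γ - β - |σ| - d)`. -/
def eigenvalue {d : ℕ} (σ : Fin d → ℝ) (β γ : ℝ) (n : ℕ) : ℝ :=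
  (n : ℝ) * (-(n : ℝ) + γ - β - total σ - d)

/-- The norm
`A_ν = (1+β)_{|ν|} Γ(1+γ) Γ(γ-β-|σ|-2|ν|-d) / (Γ(γ-|σ|-|ν|+1-d) Γ(γ-β))
  · ∏_{j=1}^d ν_j! (α_{3,j}-α_{2,j}-ν_j)_{ν_j} (α_{3,j-1}-α_{2,j-1}+1)_{ν_j} / (1+σ_j)_{ν_j}`. -/
def normA {d : ℕ} (σ : Fin d → ℝ) (β γ : ℝ) (ν : Fin d → ℕ) : ℝ :=
  poch (1 + β) (∑ i, ν i) * Real.Gamma (1 + γ) *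
      Real.Gamma (γ - β - total σ - 2 * total (toReal ν) - d) /
    (Real.Gamma (γ - total σ - total (toReal ν) + 1 - d) * Real.Gamma (γ - β)) *
  ∏ i : Fin d, ((ν i).factorial : ℝ) * poch (alphaGap σ β γ ν (i.val + 1) - (ν i : ℝ)) (ν i) *
      poch (alphaGap σ β γ ν i.val + 1) (ν i) / poch (1 + σ i) (ν i)

end

open Finset

/-! Orthogonality goes by induction on the dimension, splitting off the first coordinate. The first
factor of `multiR` depends on `x 0` alone, and the remaining coordinates see `x 0` only as a common
shift of `β` and `γ`; the weight splits in the same way (`multiR_succ`, `weight_cons`). Summing over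
the tail gives the norm at shifted parameters, and its dependence on `x 0` turns the one-variable
weight into a Gauss weight with exactly the parameters of the first factor (`normA_add`). This
leaves the case of one variable. There `R_n` is expanded in `(-x)_k` and tested against
`(α₂+1+x)_m`, Gauss's theorem (`hasSum_gauss`) sums each term, and an alternating binomial sum
remains: a finite difference that vanishes if `m < n`, a partial fraction if `m = n`.

The eigenvalue equation follows from orthogonality. On products of falling factorials `D` is
triangular, with an eigenvalue depending only on the degree, so `r = D R_ν - λ R_ν` has degree less
than `|ν|` (`diffOp_sub_mem_polyLT`). A dimension count shows that the `R_μ` of lower degree span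
all polynomials of lower degree, so `R_ν` is orthogonal to these (`hasSum_polyR_mul_polyLT`).
Detailed balance makes `D` symmetric for `W` (`hasSum_diffOp_symm`). Hence `⟨r, r⟩ = ⟨R_ν, D r⟩ - λ
⟨R_ν, r⟩ = 0`, so `r` vanishes on the lattice and therefore everywhere. The degree of `R_ν` is
exactly `|ν|`, since otherwise `R_ν` would be orthogonal to itself although its norm is positive. -/

theorem hasSum_of_eq {ι : Type*} {f g : ι → ℝ} {a b : ℝ} (h : HasSum f a) (hf : ∀ i, g i = f i)
    (hb : b = a) : HasSum g b := by
  rw [funext hf, hb]; exact h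

/-! ### Pochhammer symbols and the Gamma function -/

theorem poch_zero (a : ℝ) : poch a 0 = 1 := by simp [poch]

theorem poch_succ (a : ℝ) (n : ℕ) : poch a (n + 1) = poch a n * (a + n) := by
  simp [poch, ascPochhammer_succ_eval]

theorem poch_add (a : ℝ) (m n : ℕ) : poch a (m + n) = poch a m * poch (a + m) n := by
  induction n with
  | zero => simp [poch_zero]
  | succ n ih => rw [← add_assoc, poch_succ, poch_succ, ih]; push_cast; ring

theorem poch_succ_left (a : ℝ) (n : ℕ) : poch a (n + 1) = a * poch (a + 1) n := by
  rw [add_comm, poch_add]; simp [poch_succ, poch_zero]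

theorem poch_pos {a : ℝ} (ha : 0 < a) (n : ℕ) : 0 < poch a n := ascPochhammer_pos n a ha

theorem poch_eq_prod (a : ℝ) (n : ℕ) : poch a n = ∏ k ∈ range n, (a + k) := by
  induction n with
  | zero => simp [poch_zero]
  | succ n ih => rw [poch_succ, ih, prod_range_succ]

/-- Reflection of the Pochhammer symbol. -/
theorem poch_reflect (a : ℝ) (n : ℕ) : poch a n = (-1) ^ n * poch (1 - a - n) n := by
  rw [poch_eq_prod, poch_eq_prod, ← prod_range_reflect, show (-1 : ℝ) ^ n = ∏ _k ∈ range n, (-1 : ℝ) by simp, ← prod_mul_distrib]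
  refine prod_congr rfl fun k hk => ?_
  have hk : k < n := mem_range.mp hk
  have : ((n - 1 - k : ℕ) : ℝ) = n - 1 - k := by
    rw [Nat.sub_sub, Nat.cast_sub (by omega)]; push_cast; ring
  rw [this]; ring

theorem poch_neg_nat (n k : ℕ) :
    poch (-(n : ℝ)) k = (-1) ^ k * (n.choose k : ℝ) * (k.factorial : ℝ) := by
  rw [poch, ascPochhammer_eval_neg_eq_descPochhammer, descPochhammer_eval_eq_descFactorial,
    Nat.descFactorial_eq_factorial_mul_choose]
  push_cast; ring

theorem poch_neg_nat_eq_zero {n k : ℕ} (h : n < k) : poch (-(n : ℝ)) k = 0 := by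
  rw [poch_neg_nat, Nat.choose_eq_zero_of_lt h]; simp

theorem Gamma_add_nat {a : ℝ} (ha : 0 < a) (n : ℕ) :
    Real.Gamma (a + n) = poch a n * Real.Gamma a := by
  induction n with
  | zero => simp [poch_zero]
  | succ n ih =>
    have : a + ((n + 1 : ℕ) : ℝ) = (a + n) + 1 := by push_cast; ring
    rw [this, Real.Gamma_add_one (by positivity), ih, poch_succ]; ring

/-! ### Gauss's summation theorem -/

/-- The coefficient of the Gauss hypergeometric series. -/
noncomputable def gaussTerm (a b c : ℝ) (x : ℕ) : ℝ :=
  poch a x * poch b x / ((x.factorial : ℝ) * poch c x)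

/-- The value of the Gauss hypergeometric series at `1`. -/
noncomputable def gaussValue (a b c : ℝ) : ℝ :=
  Real.Gamma c * Real.Gamma (c - a - b) / (Real.Gamma (c - a) * Real.Gamma (c - b))

theorem choose_eq_poch_div (a : ℝ) (n : ℕ) :
    Ring.choose (a + n - 1) n = poch a n / (n.factorial : ℝ) := by
  have h := Ring.factorial_nsmul_multichoose_eq_ascPochhammer a n
  rw [Polynomial.ascPochhammer_smeval_eq_eval] at h
  rw [Ring.choose, poch, ← h]
  have : a + n - 1 - n + 1 = a := by ring
  rw [this, nsmul_eq_mul]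
  field_simp

theorem hasSum_binomial (a : ℝ) {t : ℝ} (h0 : 0 < t) (h1 : t < 1) :
    HasSum (fun n : ℕ => poch a n / (n.factorial : ℝ) * t ^ n) ((1 - t) ^ (-a)) := by
  have h := (Real.one_div_one_sub_rpow_hasFPowerSeriesOnBall_zero a).hasSum (y := t) (by
    simp [enorm_eq_nnnorm]
    rw [← NNReal.coe_lt_coe]; simpa [abs_of_pos h0])
  simp only [FormalMultilinearSeries.ofScalars_apply_eq, zero_add, choose_eq_poch_div, smul_eq_mul,
    one_div] at h
  rwa [← Real.rpow_neg (by linarith)] at h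

open MeasureTheory ProbabilityTheory in
theorem lintegral_beta {u v : ℝ} (hu : 0 < u) (hv : 0 < v) :
    ∫⁻ t in Set.Ioo (0 : ℝ) 1, ENNReal.ofReal (t ^ (u - 1) * (1 - t) ^ (v - 1)) =
      ENNReal.ofReal (beta u v) := by
  have h := lintegral_betaPDF_eq_one hu hv
  have hb := beta_pos hu hv
  rw [lintegral_betaPDF] at h
  simp_rw [mul_assoc, ENNReal.ofReal_mul (one_div_pos.2 hb).le] at h
  rw [lintegral_const_mul _ (by fun_prop)] at h
  calc _ = ENNReal.ofReal (beta u v * (1 / beta u v)) * _ := by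
        rw [mul_one_div_cancel hb.ne', ENNReal.ofReal_one, one_mul]
    _ = _ := by rw [ENNReal.ofReal_mul hb.le, mul_assoc, h, mul_one]

open MeasureTheory ProbabilityTheory in
-- Euler's method: the binomial series of `(1 - t)^(-a)` is integrated termwise against a beta
-- density. For positive parameters every term is nonnegative, so the interchange is free for lower
-- integrals, and the finite total yields convergence.
theorem hasSum_gauss {a b c : ℝ} (ha : 0 < a) (hb : 0 < b) (hc : a + b < c) :
    HasSum (gaussTerm a b c) (gaussValue a b c) := by
  have hcb : 0 < c - b := by linarith
  have hcab : 0 < c - b - a := by linarith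
  have hc0 : 0 < c := by linarith
  have key : ∑' n : ℕ, ENNReal.ofReal (poch a n / (n.factorial : ℝ) * beta (b + n) (c - b)) =
      ENNReal.ofReal (beta b (c - b - a)) := by
    have e (n : ℕ) : ENNReal.ofReal (poch a n / (n.factorial : ℝ) * beta (b + n) (c - b)) =
        ∫⁻ t in Set.Ioo (0 : ℝ) 1, ENNReal.ofReal (poch a n / (n.factorial : ℝ) *
          (t ^ (b + n - 1) * (1 - t) ^ (c - b - 1))) := by
      have hp : 0 ≤ poch a n / (n.factorial : ℝ) := by have := poch_pos ha n; positivity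
      simp_rw [ENNReal.ofReal_mul hp]
      rw [lintegral_const_mul _ (by fun_prop), lintegral_beta (by positivity) hcb]
    simp_rw [e]
    rw [← lintegral_tsum (fun n => by fun_prop), ← lintegral_beta hb hcab]
    refine setLIntegral_congr_fun measurableSet_Ioo fun t ht => ?_
    have h1 : 0 < 1 - t := by linarith [ht.2]
    have h := (hasSum_binomial a ht.1 ht.2).mul_left (t ^ (b - 1) * (1 - t) ^ (c - b - 1))
    have e2 : t ^ (b - 1) * (1 - t) ^ (c - b - 1) * (1 - t) ^ (-a) =
        t ^ (b - 1) * (1 - t) ^ (c - b - a - 1) := by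
      rw [mul_assoc, ← Real.rpow_add h1]; ring_nf
    rw [e2] at h
    have e3 (n : ℕ) : poch a n / (n.factorial : ℝ) * (t ^ (b + n - 1) * (1 - t) ^ (c - b - 1)) =
        t ^ (b - 1) * (1 - t) ^ (c - b - 1) * (poch a n / (n.factorial : ℝ) * t ^ n) := by
      rw [show b + n - 1 = (b - 1) + (n : ℕ) by ring, Real.rpow_add ht.1, Real.rpow_natCast]; ring
    simp_rw [e3]
    rw [← h.tsum_eq, ENNReal.ofReal_tsum_of_nonneg _ h.summable]
    intro n
    have := poch_pos ha n; have := ht.1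
    positivity
  have hn (n : ℕ) : 0 ≤ poch a n / (n.factorial : ℝ) * beta (b + n) (c - b) := by
    have := poch_pos ha n
    have := beta_pos (α := b + n) (β := c - b) (by positivity) hcb
    positivity
  have hs : HasSum (fun n : ℕ => poch a n / (n.factorial : ℝ) * beta (b + n) (c - b))
      (beta b (c - b - a)) := by
    have h1 := ENNReal.hasSum_toReal (f := fun n : ℕ =>
      ENNReal.ofReal (poch a n / (n.factorial : ℝ) * beta (b + n) (c - b))) (by rw [key]; simp)
    rw [← ENNReal.tsum_toReal_eq (by simp), key, ENNReal.toReal_ofReal (beta_pos hb hcab).le] at h1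
    simpa [ENNReal.toReal_ofReal (hn _)] using h1
  have hG : Real.Gamma (c - b) ≠ 0 := (Real.Gamma_pos_of_pos hcb).ne'
  have hGb : Real.Gamma b ≠ 0 := (Real.Gamma_pos_of_pos hb).ne'
  have hGc : Real.Gamma c ≠ 0 := (Real.Gamma_pos_of_pos hc0).ne'
  have hGca : Real.Gamma (c - a) ≠ 0 := (Real.Gamma_pos_of_pos (by linarith)).ne'
  refine hasSum_of_eq (hs.mul_left (Real.Gamma c / (Real.Gamma b * Real.Gamma (c - b))))
    (fun n => ?_) ?_
  · have hpc := (poch_pos hc0 n).ne'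
    rw [gaussTerm, beta, show b + n + (c - b) = c + n by ring, Gamma_add_nat hb, Gamma_add_nat hc0]
    field_simp
  · rw [gaussValue, beta, show b + (c - b - a) = c - a by ring, show c - b - a = c - a - b by ring]
    field_simp

/-! ### Orthogonality in one variable -/

/-- The `n`-th finite difference of a polynomial of degree less than `n` vanishes. -/
theorem sum_alternating_choose_mul_eval {p : Polynomial ℝ} {n : ℕ} (hp : p.natDegree < n) :
    ∑ k ∈ range (n + 1), (-1 : ℝ) ^ k * (n.choose k : ℝ) * p.eval (k : ℝ) = 0 := by
  have h := congrFun (Polynomial.fwdDiff_iter_eq_zero_of_degree_lt hp) (0 : ℝ)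
  rw [fwdDiff_iter_eq_sum_shift] at h
  simp only [Pi.zero_apply, zero_add, nsmul_eq_mul, mul_one, zsmul_eq_mul] at h
  have h2 := congrArg (fun t => (-1 : ℝ) ^ n * t) h
  simp only [mul_zero, mul_sum] at h2
  rw [← h2]
  refine sum_congr rfl fun k hk => ?_
  have hk : k ≤ n := by simpa [Nat.lt_succ_iff] using hk
  push_cast
  rw [← mul_assoc, ← mul_assoc, ← pow_add]
  congr 2
  obtain ⟨m, rfl⟩ := Nat.exists_eq_add_of_le hk
  rw [show k + m + (k + m - k) = k + 2 * m by omega, pow_add, pow_mul]; simp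

/-- The coefficients of `oneVarR` in the basis of the polynomials `(-x)_k`, written with
`a = α₁ + 1`, `b = α₂ + 1`, `c = α₃ + 1`. -/
noncomputable def rCoeff (n : ℕ) (a b c : ℝ) (k : ℕ) : ℝ :=
  poch (-(n : ℝ)) k * poch (n + (a + b - c)) k / (poch a k * poch b k * (k.factorial : ℝ))

theorem oneVarR_eq (n : ℕ) (α₁ α₂ α₃ x : ℝ) :
    oneVarR n α₁ α₂ α₃ x =
      ∑ k ∈ range (n + 1), rCoeff n (α₁ + 1) (α₂ + 1) (α₃ + 1) k * poch (-x) k := by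
  unfold oneVarR rCoeff
  refine sum_congr rfl fun k _ => ?_
  rw [show (n : ℝ) - α₃ + α₁ + α₂ + 1 = n + (α₁ + 1 + (α₂ + 1) - (α₃ + 1)) by ring]
  ring

/-- The factor `(-x)_k` kills the terms with `x < k`. After the shift `x = y + k` the symbols
recombine into a Gauss series with `a`, `b`, `c` raised by `k`, `k + m`, `k`; `h` is the convergence
condition of that series. -/
theorem hasSum_poch_mul_poch_mul_gaussTerm {a b c : ℝ} (ha : 0 < a) (hb : 0 < b) (k m : ℕ)
    (h : (k : ℝ) + m < c - a - b) :
    HasSum (fun x : ℕ => poch (-(x : ℝ)) k * poch (b + x) m * gaussTerm a b c x)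
      ((-1) ^ k * (poch a k * poch b (k + m) / poch c k) *
        gaussValue (a + k) (b + (k + m : ℕ)) (c + k)) := by
  have hc : 0 < c := by
    have : (0 : ℝ) ≤ (k : ℝ) + m := by positivity
    linarith
  have hg := (hasSum_gauss (a := a + k) (b := b + (k + m : ℕ)) (c := c + k) (by positivity)
    (by positivity) (by push_cast; linarith)).mul_left
      ((-1) ^ k * (poch a k * poch b (k + m) / poch c k))
  refine (Function.Injective.hasSum_iff (add_left_injective k) ?_).1
    (hasSum_of_eq hg (fun y => ?_) rfl)
  · intro x hx
    have : x < k := by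
      by_contra hk
      exact hx ⟨x - k, by simp; omega⟩
    rw [poch_neg_nat_eq_zero this]; simp
  · have h1 : poch a (y + k) = poch a k * poch (a + k) y := by rw [add_comm, poch_add]
    have h2 : poch c (y + k) = poch c k * poch (c + k) y := by rw [add_comm, poch_add]
    have h3 : poch b (y + k) * poch (b + (y + k : ℕ)) m =
        poch b (k + m) * poch (b + (k + m : ℕ)) y := by
      rw [← poch_add, ← poch_add]; congr 1; ring
    have h4 : poch (-((y + k : ℕ) : ℝ)) k * (y.factorial : ℝ) =
        (-1) ^ k * ((y + k).factorial : ℝ) := by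
      have := Nat.add_choose_mul_factorial_mul_factorial y k
      rw [poch_neg_nat, ← this]
      push_cast; ring
    have p1 := poch_pos hc k
    have p2 := poch_pos (a := c + k) (by positivity) y
    simp only [Function.comp_apply, gaussTerm, h1, h2]
    have f1 : ((y + k).factorial : ℝ) ≠ 0 := by positivity
    have f2 : (y.factorial : ℝ) ≠ 0 := by positivity
    have p1 := p1.ne'
    have p2 := p2.ne'
    field_simp
    linear_combination (poch (-((y + k : ℕ) : ℝ)) k * (y.factorial : ℝ)) * poch a k * poch (a + k) y * h3 +
      poch b (k + m) * poch (b + (k + m : ℕ)) y * poch a k * poch (a + k) y * h4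

/-- Partial fractions: an alternating binomial sum with one simple pole. -/
theorem sum_alternating_choose_div {z : ℝ} (n : ℕ) (hz : ∀ k ≤ n, z + k ≠ 0) :
    ∑ k ∈ range (n + 1), (-1 : ℝ) ^ k * (n.choose k : ℝ) / (z + k) =
      n.factorial / poch z (n + 1) := by
  induction n generalizing z with
  | zero => simp [poch_succ, poch_zero]
  | succ n ih =>
    have h1 := ih (z := z) fun k hk => hz k (by omega)
    have h2 := ih (z := z + 1) fun k hk => by
      have := hz (k + 1) (by omega)
      push_cast at this
      rwa [add_assoc, add_comm 1 (k : ℝ)]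
    rw [sum_range_succ'] at *
    -- Pascal's rule reduces the sum to the two sums of order `n` at `z + 1` and at `z`.
    have e : ∑ k ∈ range (n + 1), (-1 : ℝ) ^ (k + 1) * ((n + 1).choose (k + 1) : ℝ) /
        (z + (k + 1 : ℕ)) = - ∑ k ∈ range (n + 1), (-1 : ℝ) ^ k * (n.choose k : ℝ) / (z + 1 + k) +
          ∑ k ∈ range (n + 1), (-1 : ℝ) ^ (k + 1) * (n.choose (k + 1) : ℝ) / (z + (k + 1 : ℕ)) := by
      rw [← sum_neg_distrib, ← sum_add_distrib]
      refine sum_congr rfl fun k _ => ?_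
      rw [Nat.choose_succ_succ]; push_cast
      rw [show z + 1 + (k : ℝ) = z + (k + 1) by ring]
      ring
    rw [e, sum_range_succ' (fun k => (-1 : ℝ) ^ k * (n.choose k : ℝ) / (z + 1 + k)), h2,
      sum_range_succ]
    rw [Nat.choose_succ_self]
    have h3 : ∑ k ∈ range n, (-1 : ℝ) ^ (k + 1) * (n.choose (k + 1) : ℝ) / (z + (k + 1 : ℕ)) =
      n.factorial / poch z (n + 1) - (-1) ^ 0 * (n.choose 0 : ℝ) / (z + (0 : ℕ)) := by
      rw [← h1]; ring
    rw [h3]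
    have hz0 : z ≠ 0 := by simpa using hz 0 (by omega)
    have hp : ∀ m ≤ n + 2, poch z m ≠ 0 := fun m hm => by
      rw [poch_eq_prod, prod_ne_zero_iff]
      exact fun k hk => hz k (by have := mem_range.1 hk; omega)
    have hzn := hz (n + 1) le_rfl
    have e3 : poch z (n + 1 + 1) = poch z (n + 1) * (z + (n + 1 : ℕ)) := poch_succ _ _
    have e4 : poch z (n + 1 + 1) = z * poch (z + 1) (n + 1) := poch_succ_left _ _
    have hq : poch (z + 1) (n + 1) ≠ 0 := by
      intro h; rw [h, mul_zero] at e4; exact hp _ le_rfl e4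
    have hp1 := hp (n + 1) (by omega)
    have e5 : (n.factorial : ℝ) / poch (z + 1) (n + 1) = z * n.factorial / poch z (n + 2) := by
      rw [div_eq_div_iff hq (hp _ le_rfl), e4]; ring
    have e6 : (n.factorial : ℝ) / poch z (n + 1) = (z + (n + 1)) * n.factorial / poch z (n + 2) := by
      rw [div_eq_div_iff hp1 (hp _ le_rfl), e3]; push_cast; ring
    rw [e5, e6, Nat.factorial_succ]
    have := hp _ le_rfl
    push_cast
    simp only [pow_zero, Nat.choose_zero_right, Nat.cast_one]
    ring

/-- The polynomial `k ↦ (b + k)_m`. -/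
noncomputable def pochPoly (b : ℝ) (m : ℕ) : Polynomial ℝ :=
  (ascPochhammer ℝ m).comp (Polynomial.X + Polynomial.C b)

theorem pochPoly_eval (b : ℝ) (m : ℕ) (x : ℝ) : (pochPoly b m).eval x = poch (b + x) m := by
  simp [pochPoly, poch, add_comm]

theorem pochPoly_monic (b : ℝ) (m : ℕ) : (pochPoly b m).Monic :=
  (monic_ascPochhammer ℝ m).comp_X_add_C b

theorem pochPoly_natDegree (b : ℝ) (m : ℕ) : (pochPoly b m).natDegree = m := by
  rw [pochPoly, Polynomial.natDegree_comp, ascPochhammer_natDegree, Polynomial.natDegree_X_add_C,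
    mul_one]

/-- Dividing `p` by `X + z` leaves the constant `p(-z)`, covered by the simple-pole formula, and a
quotient of degree less than `n`, which the finite difference annihilates. -/
theorem sum_alternating_choose_mul_eval_div {z : ℝ} {n : ℕ} (hz : ∀ k ≤ n, z + k ≠ 0)
    {p : Polynomial ℝ} (hp : p.natDegree ≤ n) :
    ∑ k ∈ range (n + 1), (-1 : ℝ) ^ k * (n.choose k : ℝ) * p.eval (k : ℝ) / (z + k) =
      p.eval (-z) * n.factorial / poch z (n + 1) := by
  obtain rfl | hn := Nat.eq_zero_or_pos n
  · rw [Polynomial.eq_C_of_natDegree_le_zero hp]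
    simp [poch_succ, poch_zero]
  set q := p /ₘ (Polynomial.X - Polynomial.C (-z)) with hq
  have hpq : p = Polynomial.C (p.eval (-z)) + (Polynomial.X - Polynomial.C (-z)) * q := by
    rw [← Polynomial.modByMonic_X_sub_C_eq_C_eval, hq, Polynomial.modByMonic_add_div]
  have hqd : q.natDegree < n := by
    rw [hq, Polynomial.natDegree_divByMonic _ (Polynomial.monic_X_sub_C _),
      Polynomial.natDegree_X_sub_C]
    omega
  have e : ∀ k ∈ range (n + 1), (-1 : ℝ) ^ k * (n.choose k : ℝ) * p.eval (k : ℝ) / (z + k) =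
      p.eval (-z) * ((-1 : ℝ) ^ k * (n.choose k : ℝ) / (z + k)) +
        (-1 : ℝ) ^ k * (n.choose k : ℝ) * q.eval (k : ℝ) := by
    intro k hk
    have := hz k (by have := mem_range.1 hk; omega)
    have h2 : p.eval (k : ℝ) = p.eval (-z) + (z + k) * q.eval (k : ℝ) := by
      have h3 := congrArg (Polynomial.eval (k : ℝ)) hpq
      simp only [Polynomial.eval_add, Polynomial.eval_mul, Polynomial.eval_C, Polynomial.eval_sub,
        Polynomial.eval_X] at h3
      linear_combination h3
    rw [h2]
    field_simp
  rw [sum_congr rfl e, sum_add_distrib, ← mul_sum, sum_alternating_choose_div n hz,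
    sum_alternating_choose_mul_eval hqd]
  ring

/-- Isolates the dependence on `k`. The arguments of the two remaining Gamma values differ by `n - m
- 1`: their ratio is a polynomial in `k` for `m < n` and a simple pole for `m = n`. -/
theorem rCoeff_mul_gaussValue {a b c : ℝ} (ha : 0 < a) (hb : 0 < b) {n k m : ℕ} (hk : k ≤ n)
    (h : 2 * (n : ℝ) < c - a - b) :
    rCoeff n a b c k * ((-1) ^ k * (poch a k * poch b (k + m) / poch c k) *
        gaussValue (a + k) (b + (k + m : ℕ)) (c + k)) =
      Real.Gamma c * Real.Gamma (c - a - b - n + 1) / (Real.Gamma (c - a) * Real.Gamma (c - b - m)) *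
        ((-1) ^ k * (n.choose k : ℝ) * poch (b + k) m *
          (Real.Gamma (c - a - b - k - m) / Real.Gamma (c - a - b - n - k + 1))) := by
  have hkn : (k : ℝ) ≤ n := by exact_mod_cast hk
  have hn0 : (0 : ℝ) ≤ n := by positivity
  have hc : 0 < c := by linarith
  have hpa := (poch_pos ha k).ne'
  have hpb := (poch_pos hb k).ne'
  have hpc := (poch_pos hc k).ne'
  have hG := (Real.Gamma_pos_of_pos (s := c - a - b - n - k + 1) (by linarith)).ne'
  have e1 : poch (n + (a + b - c)) k =
      (-1) ^ k * (Real.Gamma (c - a - b - n + 1) / Real.Gamma (c - a - b - n - k + 1)) := by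
    rw [poch_reflect, eq_comm]
    congr 1
    rw [div_eq_iff hG, show c - a - b - n + 1 = (c - a - b - n - k + 1) + k by ring,
      Gamma_add_nat (by linarith)]
    congr 2; ring
  rw [rCoeff, gaussValue, e1, poch_neg_nat, poch_add b, Gamma_add_nat hc,
    show c + k - (a + k) = c - a by ring, show c + k - (b + (k + m : ℕ)) = c - b - m by
      push_cast; ring, show c - a - (b + (k + m : ℕ)) = c - a - b - k - m by push_cast; ring]
  have f : (k.factorial : ℝ) ≠ 0 := by positivity
  have e2 : (-1 : ℝ) ^ k * (-1) ^ k = 1 := by rw [← mul_pow]; simp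
  rw [div_mul_eq_mul_div, div_mul_eq_mul_div]
  field_simp
  linear_combination (n.choose k * Real.Gamma (c - a - b - n + 1) * poch (b + k) m *
    Real.Gamma (c - a - b - k - m) / (Real.Gamma (c - a) * Real.Gamma (c - b - m))) * e2

theorem sum_rCoeff_mul_gaussValue_lt {a b c : ℝ} (ha : 0 < a) (hb : 0 < b) {n m : ℕ} (hm : m < n)
    (h : 2 * (n : ℝ) < c - a - b) :
    ∑ k ∈ range (n + 1), rCoeff n a b c k * ((-1) ^ k * (poch a k * poch b (k + m) / poch c k) *
        gaussValue (a + k) (b + (k + m : ℕ)) (c + k)) = 0 := by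
  rw [sum_congr rfl fun k hk => rCoeff_mul_gaussValue ha hb (by simpa [Nat.lt_succ_iff] using hk) h,
    ← mul_sum]
  refine mul_eq_zero_of_right _ ?_
  -- The degree is at most `m + (n - m - 1) = n - 1`, just below the order of the difference.
  set p : Polynomial ℝ := pochPoly b m *
    (pochPoly (c - a - b - n + 1) (n - m - 1)).comp (-Polynomial.X) with hp
  have hpd : p.natDegree < n := by
    refine lt_of_le_of_lt Polynomial.natDegree_mul_le ?_
    rw [Polynomial.natDegree_comp, pochPoly_natDegree, pochPoly_natDegree, Polynomial.natDegree_neg,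
      Polynomial.natDegree_X]
    omega
  rw [← sum_alternating_choose_mul_eval hpd]
  refine sum_congr rfl fun k hk => ?_
  have hkn : (k : ℝ) ≤ n := by exact_mod_cast (show k ≤ n by simpa [Nat.lt_succ_iff] using hk)
  have hG := (Real.Gamma_pos_of_pos (s := c - a - b - n - k + 1) (by linarith)).ne'
  have e : Real.Gamma (c - a - b - k - m) / Real.Gamma (c - a - b - n - k + 1) =
      poch (c - a - b - n - k + 1) (n - m - 1) := by
    rw [div_eq_iff hG, ← Gamma_add_nat (by linarith)]
    congr 1
    rw [Nat.sub_sub, Nat.cast_sub (by omega)]; push_cast; ring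
  rw [e, hp, Polynomial.eval_mul, Polynomial.eval_comp, pochPoly_eval, pochPoly_eval]
  simp only [Polynomial.eval_neg, Polynomial.eval_X]
  rw [show c - a - b - n + 1 + -(k : ℝ) = c - a - b - n - k + 1 by ring]
  ring

theorem sum_rCoeff_mul_gaussValue_self {a b c : ℝ} (ha : 0 < a) (hb : 0 < b) {n : ℕ}
    (h : 2 * (n : ℝ) < c - a - b) :
    ∑ k ∈ range (n + 1), rCoeff n a b c k * ((-1) ^ k * (poch a k * poch b (k + n) / poch c k) *
        gaussValue (a + k) (b + (k + n : ℕ)) (c + k)) =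
      (-1) ^ n * n.factorial * Real.Gamma c * Real.Gamma (c - a - b - 2 * n) /
        (Real.Gamma (c - a - n) * Real.Gamma (c - b - n)) := by
  rw [sum_congr rfl fun k hk => rCoeff_mul_gaussValue ha hb (by simpa [Nat.lt_succ_iff] using hk) h,
    ← mul_sum]
  have hn0 : (0 : ℝ) ≤ n := by positivity
  have hz : ∀ k ≤ n, (n - (c - a - b) : ℝ) + k ≠ 0 := fun k hk => by
    have : (k : ℝ) ≤ n := by exact_mod_cast hk
    exact ne_of_lt (by linarith)
  -- The Gamma ratio is now `1 / (c - a - b - n - k)`, that is `-1 / (z + k)` with `z = n - (c - a -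
  -- b)`.
  have e : ∑ k ∈ range (n + 1), (-1 : ℝ) ^ k * (n.choose k : ℝ) * poch (b + k) n *
          (Real.Gamma (c - a - b - k - n) / Real.Gamma (c - a - b - n - k + 1)) =
      -(poch (c - a - n) n * n.factorial / poch (n - (c - a - b)) (n + 1)) := by
    have := sum_alternating_choose_mul_eval_div hz (pochPoly_natDegree b n).le
    rw [pochPoly_eval, show b + -(n - (c - a - b)) = c - a - n by ring] at this
    rw [← this, ← sum_neg_distrib]
    refine sum_congr rfl fun k hk => ?_
    have hkn : k ≤ n := by simpa [Nat.lt_succ_iff] using hk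
    have hkr : (k : ℝ) ≤ n := by exact_mod_cast hkn
    have hG := (Real.Gamma_pos_of_pos (s := c - a - b - n - k) (by linarith)).ne'
    rw [pochPoly_eval, Real.Gamma_add_one (by linarith),
      show c - a - b - k - n = c - a - b - n - k by ring]
    have h1 := hz k hkn
    have h2 : c - a - b - n - k ≠ 0 := by linarith
    rw [show (n - (c - a - b) : ℝ) + k = -(c - a - b - n - k) by ring, div_mul_cancel_right₀ hG]
    field_simp
  have h1 : poch (n - (c - a - b)) (n + 1) =
      (-1) ^ (n + 1) * (Real.Gamma (c - a - b - n + 1) / Real.Gamma (c - a - b - 2 * n)) := by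
    have hG := (Real.Gamma_pos_of_pos (s := c - a - b - 2 * n) (by linarith)).ne'
    rw [poch_reflect, eq_comm]
    congr 1
    rw [div_eq_iff hG, show c - a - b - n + 1 = (c - a - b - 2 * n) + (n + 1 : ℕ) by
      push_cast; ring, Gamma_add_nat (by linarith)]
    congr 2; push_cast; ring
  have h2 : Real.Gamma (c - a) = poch (c - a - n) n * Real.Gamma (c - a - n) := by
    rw [← Gamma_add_nat (by linarith)]; congr 1; ring
  have g1 := (Real.Gamma_pos_of_pos (s := c - a - b - 2 * n) (by linarith)).ne'
  have g2 := (Real.Gamma_pos_of_pos (s := c - a - b - n + 1) (by linarith)).ne'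
  have g3 := (Real.Gamma_pos_of_pos (s := c - a - n) (by linarith)).ne'
  have g4 := (Real.Gamma_pos_of_pos (s := c - b - n) (by linarith)).ne'
  have g5 := (poch_pos (a := c - a - n) (by linarith) n).ne'
  rw [e, h1, h2]
  have e2 : (-1 : ℝ) ^ n * (-1) ^ n = 1 := by rw [← mul_pow]; simp
  have e3 : (-1 : ℝ) ^ n ≠ 0 := by simp
  rw [pow_succ]
  generalize Real.Gamma (c - a - b - 2 * n) = G at *
  field_simp
  linear_combination -Real.Gamma c * e2

/-- The squared norm of `oneVarR n`, with `a = α₁ + 1`, `b = α₂ + 1`, `c = α₃ + 1`. -/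
noncomputable def oneVarNorm (n : ℕ) (a b c : ℝ) : ℝ :=
  n.factorial * Real.Gamma c * Real.Gamma (c - a - b - 2 * n) * poch (c - a - b - 2 * n + 1) n /
    (poch a n * poch b n * Real.Gamma (c - a - n) * Real.Gamma (c - b - n))

/-- The test functions `(α₂ + 1 + x)_m` serve in place of powers of `x` because they are absorbed
into the second Gauss parameter. -/
theorem hasSum_oneVarR_mul_poch {α₁ α₂ α₃ : ℝ} (ha : 0 < α₁ + 1) (hb : 0 < α₂ + 1) {n m : ℕ}
    (hm : m ≤ n) (h : 2 * (n : ℝ) < (α₃ + 1) - (α₁ + 1) - (α₂ + 1)) :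
    HasSum (fun x : ℕ => oneVarR n α₁ α₂ α₃ x * poch (α₂ + 1 + x) m *
        gaussTerm (α₁ + 1) (α₂ + 1) (α₃ + 1) x)
      (∑ k ∈ range (n + 1), rCoeff n (α₁ + 1) (α₂ + 1) (α₃ + 1) k * ((-1) ^ k *
        (poch (α₁ + 1) k * poch (α₂ + 1) (k + m) / poch (α₃ + 1) k) *
          gaussValue (α₁ + 1 + k) (α₂ + 1 + (k + m : ℕ)) (α₃ + 1 + k))) := by
  have hmn : (m : ℝ) ≤ n := by exact_mod_cast hm
  refine hasSum_of_eq (hasSum_sum fun k hk =>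
    (hasSum_poch_mul_poch_mul_gaussTerm (c := α₃ + 1) ha hb k m ?_).mul_left
      (rCoeff n (α₁ + 1) (α₂ + 1) (α₃ + 1) k)) (fun x => ?_) rfl
  · have : (k : ℝ) ≤ n := by exact_mod_cast (show k ≤ n by simpa [Nat.lt_succ_iff] using hk)
    linarith
  · rw [oneVarR_eq, sum_mul, sum_mul]
    exact sum_congr rfl fun k _ => by ring

theorem hasSum_oneVarR_mul_of_degree_lt {α₁ α₂ α₃ : ℝ} (ha : 0 < α₁ + 1) (hb : 0 < α₂ + 1) {n : ℕ}
    (h : 2 * (n : ℝ) < (α₃ + 1) - (α₁ + 1) - (α₂ + 1)) {N : ℕ} (hN : N ≤ n) {p : Polynomial ℝ}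
    (hp : p.degree < N) :
    HasSum (fun x : ℕ => oneVarR n α₁ α₂ α₃ x * p.eval (x : ℝ) *
        gaussTerm (α₁ + 1) (α₂ + 1) (α₃ + 1) x) 0 := by
  induction N generalizing p with
  | zero =>
    have : p = 0 := by simpa using hp
    simp [this, hasSum_zero]
  | succ N ih =>
    -- Subtracting a multiple of the monic `pochPoly` of degree `N` removes the coefficient of
    -- degree `N`.
    have hq : (p - Polynomial.C (p.coeff N) * pochPoly (α₂ + 1) N).degree < N := by
      rw [Polynomial.degree_lt_iff_coeff_zero] at hp ⊢
      intro j hj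
      obtain rfl | hj := hj.eq_or_lt
      · have := (pochPoly_monic (α₂ + 1) N).coeff_natDegree
        rw [pochPoly_natDegree] at this
        simp [this]
      · rw [Polynomial.coeff_sub, Polynomial.coeff_C_mul, hp j hj,
          Polynomial.coeff_eq_zero_of_natDegree_lt (p := pochPoly (α₂ + 1) N)
            (by rwa [pochPoly_natDegree])]
        simp
    have h1 := ih (by omega) hq
    have h2 := hasSum_oneVarR_mul_poch ha hb (m := N) (by omega) h
    rw [sum_rCoeff_mul_gaussValue_lt ha hb (by omega) h] at h2
    refine hasSum_of_eq (h1.add (h2.mul_left (p.coeff N))) (fun x => ?_) (by simp)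
    rw [Polynomial.eval_sub, Polynomial.eval_mul, Polynomial.eval_C, pochPoly_eval]
    ring

/-- `oneVarR n` as a polynomial. -/
noncomputable def oneVarPoly (n : ℕ) (a b c : ℝ) : Polynomial ℝ :=
  ∑ k ∈ range (n + 1), Polynomial.C (rCoeff n a b c k) * (ascPochhammer ℝ k).comp (-Polynomial.X)

theorem oneVarPoly_eval (n : ℕ) (α₁ α₂ α₃ x : ℝ) :
    (oneVarPoly n (α₁ + 1) (α₂ + 1) (α₃ + 1)).eval x = oneVarR n α₁ α₂ α₃ x := by
  simp [oneVarPoly, oneVarR_eq, Polynomial.eval_finsetSum, poch]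

theorem natDegree_asc_comp_neg (k : ℕ) :
    ((ascPochhammer ℝ k).comp (-Polynomial.X)).natDegree = k := by
  rw [Polynomial.natDegree_comp, ascPochhammer_natDegree, Polynomial.natDegree_neg,
    Polynomial.natDegree_X, mul_one]

theorem oneVarPoly_natDegree_le (n : ℕ) (a b c : ℝ) : (oneVarPoly n a b c).natDegree ≤ n := by
  refine Polynomial.natDegree_sum_le_of_forall_le _ _ fun k hk => ?_
  refine (Polynomial.natDegree_C_mul_le _ _).trans ?_
  rw [natDegree_asc_comp_neg]
  simpa [Nat.lt_succ_iff] using hk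

theorem oneVarPoly_coeff {n : ℕ} {a b c : ℝ} (ha : 0 < a) (hb : 0 < b) :
    (oneVarPoly n a b c).coeff n =
      (-1) ^ n * poch (c - a - b - 2 * n + 1) n / (poch a n * poch b n) := by
  have h1 : ((ascPochhammer ℝ n).comp (-Polynomial.X)).coeff n = (-1) ^ n := by
    have h := Polynomial.leadingCoeff_comp (p := ascPochhammer ℝ n) (q := -Polynomial.X)
      (by simp)
    rw [Polynomial.leadingCoeff, natDegree_asc_comp_neg] at h
    rw [h, (monic_ascPochhammer ℝ n).leadingCoeff, ascPochhammer_natDegree]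
    simp
  rw [oneVarPoly, Polynomial.finsetSum_coeff, sum_range_succ, sum_eq_zero]
  · rw [zero_add, Polynomial.coeff_C_mul, h1, rCoeff, poch_neg_nat, poch_reflect (n + _)]
    rw [show 1 - (n + (a + b - c)) - n = c - a - b - 2 * n + 1 by ring]
    have hpa := (poch_pos ha n).ne'
    have hpb := (poch_pos hb n).ne'
    have e2 : (-1 : ℝ) ^ n * (-1) ^ n = 1 := by rw [← mul_pow]; simp
    rw [Nat.choose_self]
    field_simp
    push_cast
    linear_combination poch (c - a - b - 2 * n + 1) n * e2
  · intro k hk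
    rw [Polynomial.coeff_C_mul, Polynomial.coeff_eq_zero_of_natDegree_lt, mul_zero]
    rw [natDegree_asc_comp_neg]; exact mem_range.1 hk

/-- In one of the two factors only the leading coefficient matters: modulo lower degree, which is
orthogonal to `R_n`, it is a multiple of `(α₂ + 1 + x)_n`. -/
theorem hasSum_oneVarR_sq {α₁ α₂ α₃ : ℝ} (ha : 0 < α₁ + 1) (hb : 0 < α₂ + 1) {n : ℕ}
    (h : 2 * (n : ℝ) < (α₃ + 1) - (α₁ + 1) - (α₂ + 1)) :
    HasSum (fun x : ℕ => oneVarR n α₁ α₂ α₃ x * oneVarR n α₁ α₂ α₃ x *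
        gaussTerm (α₁ + 1) (α₂ + 1) (α₃ + 1) x)
      (oneVarNorm n (α₁ + 1) (α₂ + 1) (α₃ + 1)) := by
  set p := oneVarPoly n (α₁ + 1) (α₂ + 1) (α₃ + 1) with hp
  have hq : (p - Polynomial.C (p.coeff n) * pochPoly (α₂ + 1) n).degree < n := by
    rw [Polynomial.degree_lt_iff_coeff_zero]
    intro j hj
    obtain rfl | hj := hj.eq_or_lt
    · have := (pochPoly_monic (α₂ + 1) n).coeff_natDegree
      rw [pochPoly_natDegree] at this
      simp [this]
    · rw [Polynomial.coeff_sub, Polynomial.coeff_C_mul,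
        Polynomial.coeff_eq_zero_of_natDegree_lt ((oneVarPoly_natDegree_le _ _ _ _).trans_lt hj),
        Polynomial.coeff_eq_zero_of_natDegree_lt (p := pochPoly (α₂ + 1) n)
          (by rwa [pochPoly_natDegree])]
      simp
  have h1 := hasSum_oneVarR_mul_of_degree_lt ha hb h le_rfl hq
  have h2 := hasSum_oneVarR_mul_poch ha hb (m := n) le_rfl h
  rw [sum_rCoeff_mul_gaussValue_self ha hb h] at h2
  refine hasSum_of_eq (h1.add (h2.mul_left (p.coeff n))) (fun x => ?_) ?_
  · rw [Polynomial.eval_sub, Polynomial.eval_mul, Polynomial.eval_C, pochPoly_eval, hp,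
      oneVarPoly_eval]
    ring
  · rw [hp, oneVarPoly_coeff ha hb, oneVarNorm, zero_add]
    have e2 : (-1 : ℝ) ^ n * (-1) ^ n = 1 := by rw [← mul_pow]; simp
    rw [div_mul_div_comm, mul_assoc (poch _ n * poch _ n)]
    congr 1
    linear_combination - (n.factorial * Real.Gamma (α₃ + 1) *
      Real.Gamma (α₃ + 1 - (α₁ + 1) - (α₂ + 1) - 2 * n) *
        poch (α₃ + 1 - (α₁ + 1) - (α₂ + 1) - 2 * n + 1) n) * e2

theorem hasSum_oneVarR_mul_lt {α₁ α₂ α₃ : ℝ} (ha : 0 < α₁ + 1) (hb : 0 < α₂ + 1) {n m : ℕ}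
    (hm : m < n) (h : 2 * (n : ℝ) < (α₃ + 1) - (α₁ + 1) - (α₂ + 1)) :
    HasSum (fun x : ℕ => oneVarR n α₁ α₂ α₃ x * oneVarR m α₁ α₂ α₃ x *
        gaussTerm (α₁ + 1) (α₂ + 1) (α₃ + 1) x) 0 := by
  refine hasSum_of_eq (hasSum_oneVarR_mul_of_degree_lt ha hb h le_rfl
    (p := oneVarPoly m (α₁ + 1) (α₂ + 1) (α₃ + 1)) ?_) (fun x => by rw [oneVarPoly_eval]) rfl
  refine Polynomial.degree_le_natDegree.trans_lt ?_
  exact_mod_cast (oneVarPoly_natDegree_le m _ _ _).trans_lt hm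

/-- Orthogonality of the polynomials `oneVarR`. -/
theorem hasSum_oneVarR_mul {α₁ α₂ α₃ : ℝ} (ha : 0 < α₁ + 1) (hb : 0 < α₂ + 1) {n m : ℕ}
    (hn : 2 * (n : ℝ) < (α₃ + 1) - (α₁ + 1) - (α₂ + 1))
    (hm : 2 * (m : ℝ) < (α₃ + 1) - (α₁ + 1) - (α₂ + 1)) :
    HasSum (fun x : ℕ => oneVarR n α₁ α₂ α₃ x * oneVarR m α₁ α₂ α₃ x *
        gaussTerm (α₁ + 1) (α₂ + 1) (α₃ + 1) x)
      (if n = m then oneVarNorm n (α₁ + 1) (α₂ + 1) (α₃ + 1) else 0) := by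
  obtain h | rfl | h := lt_trichotomy n m
  · rw [if_neg h.ne]
    exact hasSum_of_eq (hasSum_oneVarR_mul_lt ha hb h hm) (fun x => by ring) rfl
  · rw [if_pos rfl]
    exact hasSum_oneVarR_sq ha hb hn
  · rw [if_neg h.ne']
    exact hasSum_oneVarR_mul_lt ha hb h hn

/-! ### Splitting off the first coordinate -/

section Succ
variable {d : ℕ}

theorem tailSum_succ (y : Fin (d + 1) → ℝ) (j : ℕ) :
    tailSum y (j + 2) = tailSum (Fin.tail y) (j + 1) := by
  simp only [tailSum, sum_filter, Fin.sum_univ_succ, Fin.tail]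
  simp

theorem tailSum_one (y : Fin d → ℝ) : tailSum y 1 = total y := by
  simp [tailSum, total]

theorem headSum_zero (y : Fin d → ℝ) : headSum y 0 = 0 := by
  simp [headSum]

theorem headSum_succ (y : Fin (d + 1) → ℝ) (j : ℕ) :
    headSum y (j + 1) = y 0 + headSum (Fin.tail y) j := by
  simp only [headSum, sum_filter, Fin.sum_univ_succ, Fin.tail]
  simp

theorem total_succ (y : Fin (d + 1) → ℝ) : total y = y 0 + total (Fin.tail y) := by
  simp [total, Fin.sum_univ_succ, Fin.tail]

theorem total_toReal (ν : Fin d → ℕ) : total (toReal ν) = ((∑ i, ν i : ℕ) : ℝ) := by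
  simp [total, toReal]

theorem tail_toReal (ν : Fin (d + 1) → ℕ) : Fin.tail (toReal ν) = toReal (Fin.tail ν) := rfl

theorem alpha2_succ (β : ℝ) (ν : Fin (d + 1) → ℕ) (x : Fin (d + 1) → ℝ) (j : ℕ) :
    alpha2 β ν x (j + 2) = alpha2 (β + x 0) (Fin.tail ν) (Fin.tail x) (j + 1) := by
  simp only [alpha2, Nat.add_sub_cancel, show j + 2 - 1 = j + 1 by omega, headSum_succ]
  rw [show j + 2 + 1 = (j + 1) + 2 by ring, tailSum_succ, tail_toReal]
  ring

theorem alpha3_succ (σ : Fin (d + 1) → ℝ) (γ : ℝ) (ν : Fin (d + 1) → ℕ) (x : Fin (d + 1) → ℝ)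
    (j : ℕ) :
    alpha3 σ γ ν x (j + 2) =
      alpha3 (Fin.tail σ) (γ + x 0) (Fin.tail ν) (Fin.tail x) (j + 1) := by
  simp only [alpha3, Nat.add_sub_cancel, show j + 2 - 1 = j + 1 by omega, headSum_succ]
  rw [show j + 2 + 1 = (j + 1) + 2 by ring, tailSum_succ, tailSum_succ, tail_toReal]
  push_cast
  ring

theorem alpha2_one (β : ℝ) (ν : Fin (d + 1) → ℕ) (x : Fin (d + 1) → ℝ) :
    alpha2 β ν x 1 = β + total (toReal (Fin.tail ν)) := by
  rw [alpha2, show 1 + 1 = 0 + 2 by rfl, tailSum_succ, tailSum_one, headSum_zero, tail_toReal,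
    add_zero]

theorem alpha3_one (σ : Fin (d + 1) → ℝ) (γ : ℝ) (ν : Fin (d + 1) → ℕ) (x : Fin (d + 1) → ℝ) :
    alpha3 σ γ ν x 1 = γ - total (toReal (Fin.tail ν)) - total (Fin.tail σ) - d := by
  rw [alpha3, show 1 + 1 = 0 + 2 by rfl, tailSum_succ, tailSum_succ, tailSum_one, tailSum_one,
    headSum_zero, tail_toReal]
  push_cast; ring

theorem alphaGap_succ (σ : Fin (d + 1) → ℝ) (β γ : ℝ) (ν : Fin (d + 1) → ℕ) (j : ℕ) :
    alphaGap σ β γ ν (j + 1) = alphaGap (Fin.tail σ) β γ (Fin.tail ν) j := by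
  rw [alphaGap, alphaGap, tailSum_succ, tailSum_succ, tail_toReal]
  push_cast; ring

theorem alphaGap_zero (σ : Fin d → ℝ) (β γ : ℝ) (ν : Fin d → ℕ) :
    alphaGap σ β γ ν 0 = γ - β - 2 * total (toReal ν) - total σ - d := by
  rw [alphaGap, tailSum_one, tailSum_one]
  push_cast; ring

theorem alphaGap_add (σ : Fin d → ℝ) (β γ t : ℝ) (ν : Fin d → ℕ) (j : ℕ) :
    alphaGap σ (β + t) (γ + t) ν j = alphaGap σ β γ ν j := by
  unfold alphaGap; ring

theorem multiR_succ (σ : Fin (d + 1) → ℝ) (β γ : ℝ) (ν : Fin (d + 1) → ℕ) (x : Fin (d + 1) → ℝ) :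
    multiR σ β γ ν x = poch (β + total (toReal (Fin.tail ν)) + 1) (ν 0) *
      oneVarR (ν 0) (σ 0) (β + total (toReal (Fin.tail ν)))
        (γ - total (toReal (Fin.tail ν)) - total (Fin.tail σ) - d) (x 0) *
      multiR (Fin.tail σ) (β + x 0) (γ + x 0) (Fin.tail ν) (Fin.tail x) := by
  rw [multiR, Fin.prod_univ_succ]
  simp only [Fin.val_zero, zero_add, alpha2_one, alpha3_one, Fin.val_succ, add_assoc, one_add_one_eq_two]
  simp only [alpha2_succ, alpha3_succ, multiR, Fin.tail]

theorem weight_cons (σ : Fin (d + 1) → ℝ) (β γ : ℝ) (n : ℕ) (y : Fin d → ℕ) :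
    weight σ β γ (Fin.cons n y) =
      poch (σ 0 + 1) n / n.factorial * (poch (β + 1) n / poch (γ + 1) n) *
        weight (Fin.tail σ) (β + n) (γ + n) y := by
  simp only [weight, Fin.prod_univ_succ, Fin.sum_univ_succ, Fin.cons_zero, Fin.cons_succ, poch_add,
    Fin.tail]
  rw [show β + 1 + n = β + n + 1 by ring, show γ + 1 + n = γ + n + 1 by ring]
  ring

theorem weight_pos {σ : Fin d → ℝ} {β γ : ℝ} (hσ : ∀ i, -1 < σ i) (hβ : -1 < β) (hγ : -1 < γ)
    (x : Fin d → ℕ) : 0 < weight σ β γ x := by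
  refine mul_pos (prod_pos fun i _ => div_pos (poch_pos (by linarith [hσ i]) _) (by positivity))
    (div_pos (poch_pos (by linarith) _) (poch_pos (by linarith) _))

theorem total_add_card_nonneg {σ : Fin d → ℝ} (hσ : ∀ i, -1 < σ i) : 0 ≤ total σ + d := by
  have : total σ + d = ∑ i, (σ i + 1) := by simp [total, sum_add_distrib]
  rw [this]
  exact sum_nonneg fun i _ => by linarith [hσ i]

theorem total_toReal_nonneg (ν : Fin d → ℕ) : 0 ≤ total (toReal ν) := by
  rw [total_toReal]; positivity

/-- The parameter gaps do not feel the common shift by `n`, so only one Pochhammer symbol and two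
Gamma values of the norm vary. Together with the first-coordinate weight they form a Gauss weight
with `b = α_{2,1} + 1` and `c = α_{3,1} + 1`, where the indices refer to the problem with one more
coordinate. -/
theorem normA_add {σ : Fin d → ℝ} {β γ : ℝ} (hγ : -1 < γ) (n : ℕ) (ν : Fin d → ℕ)
    (s : ℝ) (hc : 0 < γ - total (toReal ν) - total σ - d + 1) :
    poch s n / n.factorial * (poch (β + 1) n / poch (γ + 1) n) * normA σ (β + n) (γ + n) ν =
      normA σ β γ ν * gaussTerm s (β + total (toReal ν) + 1)
        (γ - total (toReal ν) - total σ - d + 1) n := by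
  have e1 : poch (β + 1) n * poch (1 + (β + n)) (∑ i, ν i) =
      poch (1 + β) (∑ i, ν i) * poch (β + total (toReal ν) + 1) n := by
    rw [total_toReal, show β + ((∑ i, ν i : ℕ) : ℝ) + 1 = 1 + β + (∑ i, ν i : ℕ) by ring, ← poch_add,
      show 1 + (β + n) = β + 1 + n by ring, ← poch_add, add_comm n, add_comm β]
  have e2 : Real.Gamma (1 + (γ + n)) = poch (γ + 1) n * Real.Gamma (1 + γ) := by
    rw [show 1 + (γ + n) = (γ + 1) + n by ring, Gamma_add_nat (by linarith), add_comm γ]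
  have e3 : Real.Gamma (γ + n - total σ - total (toReal ν) + 1 - d) =
      poch (γ - total (toReal ν) - total σ - d + 1) n *
        Real.Gamma (γ - total σ - total (toReal ν) + 1 - d) := by
    rw [show γ + n - total σ - total (toReal ν) + 1 - d =
      γ - total (toReal ν) - total σ - d + 1 + n by ring, Gamma_add_nat hc]
    congr 2; ring
  have p1 := (poch_pos hc n).ne'
  have p2 := (poch_pos (a := γ + 1) (by linarith) n).ne'
  simp only [normA, gaussTerm, alphaGap_add, e2, e3]
  rw [show γ + n - (β + n) = γ - β by ring]
  generalize Real.Gamma (γ - β - total σ - 2 * total (toReal ν) - d) = G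
  generalize Real.Gamma (γ - total σ - total (toReal ν) + 1 - d) = G'
  generalize (∏ i : Fin d, _ : ℝ) = Q
  generalize poch (γ - total (toReal ν) - total σ - d + 1) n = p at *
  field_simp
  linear_combination G * Real.Gamma (1 + γ) * Q * poch s n / (G' * Real.Gamma (γ - β)) * e1

theorem normA_succ {σ : Fin (d + 1) → ℝ} {β γ : ℝ} (hσ : ∀ i, -1 < σ i) (hβ : -1 < β)
    (ν : Fin (d + 1) → ℕ)
    (h : 2 * total (toReal ν) < γ - total σ - β - (d + 1 : ℕ)) :
    normA σ β γ ν = normA (Fin.tail σ) β γ (Fin.tail ν) *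
      poch (β + total (toReal (Fin.tail ν)) + 1) (ν 0) ^ 2 *
        oneVarNorm (ν 0) (σ 0 + 1) (β + total (toReal (Fin.tail ν)) + 1)
          (γ - total (toReal (Fin.tail ν)) - total (Fin.tail σ) - d + 1) := by
  have hN := total_toReal_nonneg (Fin.tail ν)
  have hn : (0 : ℝ) ≤ ν 0 := by positivity
  have hs := hσ 0
  rw [total_succ (toReal ν), tail_toReal, total_succ σ] at h
  simp only [normA, Fin.prod_univ_succ, Fin.sum_univ_succ, alphaGap_succ, Fin.val_succ, Fin.val_zero,
    alphaGap_zero, total_succ (toReal ν), total_succ σ, tail_toReal]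
  rw [show (toReal ν 0 : ℝ) = ν 0 from rfl] at *
  push_cast at h ⊢
  unfold oneVarNorm
  set N := total (toReal (Fin.tail ν)) with hNdef
  set S := total (Fin.tail σ)
  have e1 : poch (1 + β) (ν 0 + ∑ i : Fin d, ν i.succ) =
      poch (1 + β) (∑ i : Fin d, Fin.tail ν i) * poch (β + N + 1) (ν 0) := by
    rw [add_comm (ν 0), poch_add, hNdef, total_toReal]
    simp only [Fin.tail]
    congr 2; ring
  have hb := (poch_pos (a := β + N + 1) (by linarith) (ν 0)).ne'
  have g1 := (Real.Gamma_pos_of_pos (s := γ - S - N + 1 - d) (by linarith)).ne'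
  -- Trades the Gamma value in the norm of the tail for the one in the one-variable norm; the
  -- quotient is the factor `(α_{3,1} - α_{2,1} - ν_1)_{ν_1}`.
  have g2 : Real.Gamma (γ - β - S - 2 * N - d) = poch (γ - β - 2 * N - S - d - ν 0) (ν 0) *
      Real.Gamma (γ - N - S - d + 1 - (β + N + 1) - ν 0) := by
    rw [show γ - β - S - 2 * N - d = (γ - β - 2 * N - S - d - ν 0) + ν 0 by ring,
      Gamma_add_nat (by linarith)]
    congr 2; ring
  have g3 := (Real.Gamma_pos_of_pos (s := γ - N - S - d + 1 - (β + N + 1) - ν 0) (by linarith)).ne'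
  rw [e1, g2, show γ - N - S - d + 1 - (σ 0 + 1) - (β + N + 1) - 2 * ν 0 =
      γ - β - 2 * (ν 0 + N) - (σ 0 + S) - (d + 1) by ring,
    show γ - β - (σ 0 + S) - 2 * (ν 0 + N) - (d + 1) =
      γ - β - 2 * (ν 0 + N) - (σ 0 + S) - (d + 1) by ring,
    show γ - N - S - d + 1 - (σ 0 + 1) - ν 0 = γ - (σ 0 + S) - (ν 0 + N) + 1 - (d + 1) by ring]
  generalize Real.Gamma (γ - N - S - d + 1 - (β + N + 1) - ν 0) = G1 at *
  rw [show γ - N - S - d + 1 = γ - S - N + 1 - d by ring, add_comm (σ 0) 1]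
  generalize Real.Gamma (γ - S - N + 1 - d) = G2 at *
  generalize poch (β + N + 1) (ν 0) = p at *
  generalize Real.Gamma (γ - β - 2 * (ν 0 + N) - (σ 0 + S) - (d + 1)) = G3
  generalize Real.Gamma (γ - (σ 0 + S) - (ν 0 + N) + 1 - (d + 1)) = G4
  generalize (poch (γ - β - 2 * N - S - d - ν 0) (ν 0)) = p2
  generalize poch (γ - β - 2 * (ν 0 + N) - (σ 0 + S) - (d + 1) + 1) (ν 0) = p3
  have e5 : (∏ i : Fin d, ((ν i.succ).factorial : ℝ) *
      poch (alphaGap (Fin.tail σ) β γ (Fin.tail ν) (i.val + 1) - ν i.succ) (ν i.succ) *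
        poch (alphaGap (Fin.tail σ) β γ (Fin.tail ν) i.val + 1) (ν i.succ) /
          poch (1 + σ i.succ) (ν i.succ)) = (∏ i : Fin d, ((Fin.tail ν i).factorial : ℝ) *
      poch (alphaGap (Fin.tail σ) β γ (Fin.tail ν) (i.val + 1) - Fin.tail ν i) (Fin.tail ν i) *
        poch (alphaGap (Fin.tail σ) β γ (Fin.tail ν) i.val + 1) (Fin.tail ν i) /
          poch (1 + Fin.tail σ i) (Fin.tail ν i)) := rfl
  rw [e5]
  generalize (∏ i : Fin d, _ : ℝ) = Q
  field_simp

end Succ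

/-! ### Orthogonality in several variables -/

/-- Fubini and Tonelli in one statement. Nonnegative summands (squares) need no prior summability;
products of changing sign do. -/
theorem hasSum_fin_succ {d : ℕ} {f : (Fin (d + 1) → ℕ) → ℝ} {g : ℕ → ℝ} {a : ℝ}
    (hf : Summable f ∨ ∀ x, 0 ≤ f x) (h1 : ∀ n, HasSum (fun y => f (Fin.cons n y)) (g n))
    (h2 : HasSum g a) : HasSum f a := by
  have hs : Summable (f ∘ Fin.consEquiv (fun _ => ℕ)) := by
    obtain hf | hf := hf
    · exact (Equiv.summable_iff _).2 hf
    · rw [summable_prod_of_nonneg (f := f ∘ Fin.consEquiv (fun _ => ℕ)) (fun p => hf _)]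
      refine ⟨fun n => (h1 n).summable, ?_⟩
      have : (fun n => ∑' y, (f ∘ Fin.consEquiv (fun _ => ℕ)) (n, y)) = g :=
        funext fun n => (h1 n).tsum_eq
      rw [this]
      exact h2.summable
  have h3 := hs.hasSum.prod_fiberwise h1
  rw [← Equiv.hasSum_iff (Fin.consEquiv (fun _ => ℕ)), ← h3.unique h2]
  exact hs.hasSum

theorem hasSum_multiR_mul_step {d : ℕ} {σ : Fin (d + 1) → ℝ} {β γ : ℝ} (hσ : ∀ i, -1 < σ i)
    (hβ : -1 < β) {ν μ : Fin (d + 1) → ℕ}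
    (hν : 2 * total (toReal ν) < γ - total σ - β - (d + 1 : ℕ))
    (hμ : 2 * total (toReal μ) < γ - total σ - β - (d + 1 : ℕ))
    (ih : ∀ n : ℕ, HasSum (fun y : Fin d → ℕ =>
      multiR (Fin.tail σ) (β + n) (γ + n) (Fin.tail ν) (toReal y) *
        multiR (Fin.tail σ) (β + n) (γ + n) (Fin.tail μ) (toReal y) *
          weight (Fin.tail σ) (β + n) (γ + n) y)
      (if Fin.tail ν = Fin.tail μ then normA (Fin.tail σ) (β + n) (γ + n) (Fin.tail ν) else 0))
    (hf : (Summable fun x : Fin (d + 1) → ℕ =>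
        multiR σ β γ ν (toReal x) * multiR σ β γ μ (toReal x) * weight σ β γ x) ∨
      ∀ x : Fin (d + 1) → ℕ,
        0 ≤ multiR σ β γ ν (toReal x) * multiR σ β γ μ (toReal x) * weight σ β γ x) :
    HasSum (fun x : Fin (d + 1) → ℕ =>
        multiR σ β γ ν (toReal x) * multiR σ β γ μ (toReal x) * weight σ β γ x)
      (if ν = μ then normA σ β γ ν else 0) := by
  have h1 (n : ℕ) := ((ih n).mul_left
    (poch (β + total (toReal (Fin.tail ν)) + 1) (ν 0) *
      oneVarR (ν 0) (σ 0) (β + total (toReal (Fin.tail ν)))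
        (γ - total (toReal (Fin.tail ν)) - total (Fin.tail σ) - d) n *
     (poch (β + total (toReal (Fin.tail μ)) + 1) (μ 0) *
      oneVarR (μ 0) (σ 0) (β + total (toReal (Fin.tail μ)))
        (γ - total (toReal (Fin.tail μ)) - total (Fin.tail σ) - d) n) *
      (poch (σ 0 + 1) n / n.factorial * (poch (β + 1) n / poch (γ + 1) n))))
  refine hasSum_fin_succ hf (fun n => hasSum_of_eq (h1 n) (fun y => ?_) rfl) ?_
  · rw [multiR_succ, multiR_succ, weight_cons]
    have e1 : toReal (Fin.cons n y : Fin (d + 1) → ℕ) 0 = n := rfl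
    have e2 : Fin.tail (toReal (Fin.cons n y : Fin (d + 1) → ℕ)) = toReal y := rfl
    rw [e1, e2]
    ring
  · by_cases ht : Fin.tail ν = Fin.tail μ
    · have hμ0 : (0 : ℝ) ≤ μ 0 := by positivity
      have hν0 : (0 : ℝ) ≤ ν 0 := by positivity
      have hs := hσ 0
      have hN := total_toReal_nonneg (Fin.tail ν)
      have hA := normA_succ hσ hβ ν hν
      rw [total_succ, total_succ σ] at hν hμ
      rw [tail_toReal] at hν hμ
      rw [show toReal ν 0 = ν 0 from rfl] at hν
      rw [show toReal μ 0 = μ 0 from rfl] at hμ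
      push_cast at hν hμ
      simp only [← ht, if_true] at hν hμ ⊢
      set N := total (toReal (Fin.tail ν))
      set S := total (Fin.tail σ)
      have hS : 0 ≤ S + d := total_add_card_nonneg (σ := Fin.tail σ) fun i => hσ i.succ
      have h2 := (hasSum_oneVarR_mul (α₁ := σ 0) (α₂ := β + N) (α₃ := γ - N - S - d) (n := ν 0)
        (m := μ 0) (by linarith) (by linarith) (by linarith) (by linarith)).mul_left
          (poch (β + N + 1) (ν 0) * poch (β + N + 1) (μ 0) * normA (Fin.tail σ) β γ (Fin.tail ν))
      refine hasSum_of_eq h2 (fun n => ?_) ?_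
      · rw [mul_assoc _ (poch (σ 0 + 1) n / _ * _), normA_add (by linarith) n _ _ (by linarith)]
        ring
      · by_cases h0 : ν 0 = μ 0
        · have : ν = μ := by
            rw [← Fin.cons_self_tail ν, ← Fin.cons_self_tail μ, h0, ht]
          rw [if_pos h0, if_pos this, hA, h0]
          ring
        · rw [if_neg h0, if_neg fun h => h0 (congrFun h 0)]
          simp
    -- Unequal tails make every inner sum vanish, so the first factors, whose parameters may then
    -- differ, need not be compared.
    · rw [if_neg fun h => ht (congrArg Fin.tail h)]
      simp [ht, hasSum_zero]

/-- Orthogonality of the polynomials `multiR`. -/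
theorem hasSum_multiR_mul {d : ℕ} {σ : Fin d → ℝ} {β γ : ℝ} (hσ : ∀ i, -1 < σ i)
    (hβ : -1 < β) {ν μ : Fin d → ℕ}
    (hν : 2 * total (toReal ν) < γ - total σ - β - d)
    (hμ : 2 * total (toReal μ) < γ - total σ - β - d) :
    HasSum (fun x : Fin d → ℕ =>
        multiR σ β γ ν (toReal x) * multiR σ β γ μ (toReal x) * weight σ β γ x)
      (if ν = μ then normA σ β γ ν else 0) := by
  induction d generalizing β γ with
  | zero =>
    have e : ν = μ := Subsingleton.elim _ _
    have h0 : total σ = 0 := by simp [total]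
    have h1 : total (toReal ν) = 0 := by simp [total]
    rw [h0, h1] at hν
    push_cast at hν
    have g1 := (Real.Gamma_pos_of_pos (s := 1 + γ) (by linarith)).ne'
    have g2 := (Real.Gamma_pos_of_pos (s := γ - β) (by linarith)).ne'
    have hA : normA σ β γ ν = 1 := by
      simp only [normA, h0, h1]
      simp [poch_zero]
      rw [add_comm γ 1]
      field_simp
    rw [if_pos e, hA]
    refine hasSum_of_eq (hasSum_unique (fun _ : Fin 0 → ℕ => (1 : ℝ))) (fun x => ?_) rfl
    simp [multiR, weight, poch_zero]
  | succ d ih =>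
    have hS := total_add_card_nonneg hσ
    have hγ : -1 < γ := by have := total_toReal_nonneg ν; linarith
    have hstep : ∀ {ν μ : Fin (d + 1) → ℕ},
        2 * total (toReal ν) < γ - total σ - β - (d + 1 : ℕ) →
        2 * total (toReal μ) < γ - total σ - β - (d + 1 : ℕ) → ∀ n : ℕ, HasSum (fun y : Fin d → ℕ =>
          multiR (Fin.tail σ) (β + n) (γ + n) (Fin.tail ν) (toReal y) *
            multiR (Fin.tail σ) (β + n) (γ + n) (Fin.tail μ) (toReal y) *
            weight (Fin.tail σ) (β + n) (γ + n) y)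
          (if Fin.tail ν = Fin.tail μ then
            normA (Fin.tail σ) (β + n) (γ + n) (Fin.tail ν) else 0) := by
      intro ν μ hν hμ n
      have hn : (0 : ℝ) ≤ n := by positivity
      have hs := hσ 0
      have hν0 : 0 ≤ toReal ν 0 := Nat.cast_nonneg _
      have hμ0 : 0 ≤ toReal μ 0 := Nat.cast_nonneg _
      rw [total_succ, total_succ σ] at hν hμ
      rw [tail_toReal] at hν hμ
      push_cast at hν hμ
      exact ih (σ := Fin.tail σ) (fun i => hσ i.succ) (by linarith) (by linarith) (by linarith)
    -- The squares come first, by Tonelli. They then dominate the mixed products through `|uv| ≤ u²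
    -- + v²`, which supplies the summability that Fubini needs.
    have hdiag : ∀ {ν : Fin (d + 1) → ℕ}, 2 * total (toReal ν) < γ - total σ - β - (d + 1 : ℕ) →
        Summable fun x : Fin (d + 1) → ℕ =>
          multiR σ β γ ν (toReal x) * multiR σ β γ ν (toReal x) * weight σ β γ x := fun h =>
      (hasSum_multiR_mul_step hσ hβ h h (hstep h h) (Or.inr fun x =>
        mul_nonneg (mul_self_nonneg _) (weight_pos hσ hβ hγ x).le)).summable
    refine hasSum_multiR_mul_step hσ hβ hν hμ (hstep hν hμ) (Or.inl ?_)
    refine Summable.of_norm_bounded ((hdiag hν).add (hdiag hμ)) fun x => ?_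
    have hw := (weight_pos hσ hβ hγ x).le
    rw [Real.norm_eq_abs, abs_mul, abs_of_nonneg hw, ← add_mul]
    refine mul_le_mul_of_nonneg_right ?_ hw
    rw [abs_le]
    constructor <;> nlinarith [sq_nonneg (multiR σ β γ ν (toReal x) + multiR σ β γ μ (toReal x)),
      sq_nonneg (multiR σ β γ ν (toReal x) - multiR σ β γ μ (toReal x)),
      sq_nonneg (multiR σ β γ ν (toReal x)), sq_nonneg (multiR σ β γ μ (toReal x))]

/-- By the recursion for the norm, every Gamma and Pochhammer argument is positive in the given
range. Nonzero norms drive the linear independence, the exact degree and the dimension count. -/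
theorem normA_pos {d : ℕ} {σ : Fin d → ℝ} {β γ : ℝ} (hσ : ∀ i, -1 < σ i)
    (hβ : -1 < β) {ν : Fin d → ℕ} (hν : 2 * total (toReal ν) < γ - total σ - β - d) :
    0 < normA σ β γ ν := by
  induction d with
  | zero =>
    have h0 : total σ = 0 := by simp [total]
    have h1 : total (toReal ν) = 0 := by simp [total]
    rw [h0, h1] at hν
    push_cast at hν
    have g1 := (Real.Gamma_pos_of_pos (s := 1 + γ) (by linarith))
    have g2 := (Real.Gamma_pos_of_pos (s := γ - β) (by linarith))
    simp only [normA, h0, h1]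
    simp [poch_zero]
    rw [add_comm γ 1]
    positivity
  | succ d ih =>
    rw [normA_succ hσ hβ ν hν]
    have hν0 : (0 : ℝ) ≤ ν 0 := by positivity
    have hs := hσ 0
    have hN := total_toReal_nonneg (Fin.tail ν)
    have hS : 0 ≤ total (Fin.tail σ) + d := total_add_card_nonneg (σ := Fin.tail σ) fun i => hσ i.succ
    rw [total_succ, total_succ σ, tail_toReal, show toReal ν 0 = ν 0 from rfl] at hν
    push_cast at hν
    have h1 := ih (σ := Fin.tail σ) (ν := Fin.tail ν) (fun i => hσ i.succ) (by linarith)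
    have h2 := poch_pos (a := β + total (toReal (Fin.tail ν)) + 1) (by linarith) (ν 0)
    have h3 : 0 < oneVarNorm (ν 0) (σ 0 + 1) (β + total (toReal (Fin.tail ν)) + 1)
        (γ - total (toReal (Fin.tail ν)) - total (Fin.tail σ) - d + 1) := by
      unfold oneVarNorm
      refine div_pos (mul_pos (mul_pos (mul_pos (by positivity) (Real.Gamma_pos_of_pos ?_))
        (Real.Gamma_pos_of_pos ?_)) (poch_pos ?_ _)) (mul_pos (mul_pos (mul_pos (poch_pos ?_ _) h2)
          (Real.Gamma_pos_of_pos ?_)) (Real.Gamma_pos_of_pos ?_)) <;> linarith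
    positivity

/-! ### Action of the operator on falling factorials -/

theorem descPochhammer_eval_succ_left (t : ℝ) (k : ℕ) :
    (descPochhammer ℝ (k + 1)).eval t = t * (descPochhammer ℝ k).eval (t - 1) := by
  simp [descPochhammer_succ_left]

/-- The product of falling factorials `∏ x_i (x_i - 1) ⋯ (x_i - k_i + 1)`. -/
noncomputable def fallProd {d : ℕ} (k : Fin d → ℕ) (x : Fin d → ℝ) : ℝ :=
  ∏ i, (descPochhammer ℝ (k i)).eval (x i)

/-- The multi-index `k - e_i` (truncated). -/
def predIdx {d : ℕ} (k : Fin d → ℕ) (i : Fin d) : Fin d → ℕ := Function.update k i (k i - 1)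

section Fall
variable {d : ℕ}

theorem fallProd_update (k : Fin d → ℕ) (i : Fin d) (m : ℕ) (x : Fin d → ℝ) :
    fallProd (Function.update k i m) x = (descPochhammer ℝ m).eval (x i) *
      ∏ j ∈ univ.erase i, (descPochhammer ℝ (k j)).eval (x j) := by
  rw [fallProd, ← mul_prod_erase univ _ (mem_univ i), Function.update_self]
  congr 1
  refine prod_congr rfl fun j hj => ?_
  rw [Function.update_of_ne (ne_of_mem_erase hj)]

theorem fallProd_add_single (k : Fin d → ℕ) (i : Fin d) (t : ℝ) (x : Fin d → ℝ) :
    fallProd k (x + Pi.single i t) = (descPochhammer ℝ (k i)).eval (x i + t) *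
      ∏ j ∈ univ.erase i, (descPochhammer ℝ (k j)).eval (x j) := by
  rw [fallProd, ← mul_prod_erase univ _ (mem_univ i), Pi.add_apply, Pi.single_eq_same]
  congr 1
  refine prod_congr rfl fun j hj => ?_
  rw [Pi.add_apply, Pi.single_eq_of_ne (ne_of_mem_erase hj), add_zero]

theorem fallProd_eq (k : Fin d → ℕ) (i : Fin d) (x : Fin d → ℝ) :
    fallProd k x = (descPochhammer ℝ (k i)).eval (x i) *
      ∏ j ∈ univ.erase i, (descPochhammer ℝ (k j)).eval (x j) :=
  (mul_prod_erase univ _ (mem_univ i)).symm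

/-- Falling factorials play the role of monomials, with `△_i` as derivative. The truncation in
`predIdx` is harmless because the factor `k i` vanishes there. -/
theorem forwardDiff_fallProd (k : Fin d → ℕ) (i : Fin d) (x : Fin d → ℝ) :
    forwardDiff i (fallProd k) x = k i * fallProd (predIdx k i) x := by
  rw [forwardDiff, fallProd_add_single, fallProd_eq k i, predIdx, fallProd_update]
  obtain h | ⟨m, h⟩ : k i = 0 ∨ ∃ m, k i = m + 1 := by cases k i <;> simp
  · rw [h]; simp
  · rw [h, descPochhammer_eval_succ_left, descPochhammer_succ_eval, Nat.add_sub_cancel,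
      add_sub_cancel_right]
    push_cast; ring

theorem mul_backwardDiff_fallProd (k : Fin d → ℕ) (i : Fin d) (x : Fin d → ℝ) :
    x i * backwardDiff i (fallProd k) x = k i * fallProd k x := by
  rw [backwardDiff, sub_eq_add_neg x, ← Pi.single_neg, fallProd_add_single, fallProd_eq k i]
  obtain h | ⟨m, h⟩ : k i = 0 ∨ ∃ m, k i = m + 1 := by cases k i <;> simp
  · rw [h]; simp
  · rw [h, descPochhammer_succ_eval _ (x i + -1), descPochhammer_eval_succ_left, ← sub_eq_add_neg]
    push_cast; ring

theorem mul_fallProd (k : Fin d → ℕ) (i : Fin d) (x : Fin d → ℝ) :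
    x i * fallProd k x = fallProd (Function.update k i (k i + 1)) x + k i * fallProd k x := by
  rw [fallProd_update, fallProd_eq k i, descPochhammer_succ_eval]
  ring

theorem update_predIdx {k : Fin d → ℕ} {i : Fin d} (h : k i ≠ 0) :
    Function.update (predIdx k i) i (predIdx k i i + 1) = k := by
  rw [predIdx, Function.update_self, Function.update_idem, Nat.sub_add_cancel (by omega),
    Function.update_eq_self]

theorem sum_update_succ (k : Fin d → ℕ) (i : Fin d) :
    ∑ j, Function.update k i (k i + 1) j = ∑ j, k j + 1 := by
  rw [sum_update_of_mem (mem_univ i), ← add_sum_erase univ k (mem_univ i), sdiff_singleton_eq_erase]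
  ring

theorem sum_predIdx {k : Fin d → ℕ} {i : Fin d} (h : k i ≠ 0) :
    ∑ j, predIdx k i j + 1 = ∑ j, k j := by
  rw [← sum_update_succ, update_predIdx h]

theorem mul_fallProd_predIdx {k : Fin d → ℕ} {i : Fin d} (h : k i ≠ 0) (x : Fin d → ℝ) :
    x i * fallProd (predIdx k i) x = fallProd k x + (k i - 1) * fallProd (predIdx k i) x := by
  rw [mul_fallProd, update_predIdx h]
  congr 2
  rw [predIdx, Function.update_self, Nat.cast_sub (by omega)]
  simp

theorem forwardDiff_backwardDiff_comm (i j : Fin d) (f : (Fin d → ℝ) → ℝ) :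
    forwardDiff i (backwardDiff j f) = backwardDiff j (forwardDiff i f) := by
  funext x
  simp only [forwardDiff, backwardDiff]
  rw [show x + Pi.single i 1 - Pi.single j 1 = x - Pi.single j 1 + Pi.single i (1 : ℝ) by abel]
  ring

theorem backwardDiff_const_mul (j : Fin d) (c : ℝ) (f : (Fin d → ℝ) → ℝ) (x : Fin d → ℝ) :
    backwardDiff j (fun y => c * f y) x = c * backwardDiff j f x := by
  simp only [backwardDiff]; ring

theorem mul_forwardDiff_backwardDiff_fallProd (k : Fin d → ℕ) (i j : Fin d) (x : Fin d → ℝ) :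
    x j * forwardDiff i (backwardDiff j (fallProd k)) x =
      k i * (predIdx k i j * fallProd (predIdx k i) x) := by
  rw [forwardDiff_backwardDiff_comm, funext (forwardDiff_fallProd k i), backwardDiff_const_mul,
    ← mul_backwardDiff_fallProd]
  ring

/-- The action of `diffOp` on products of falling factorials is triangular. -/
theorem diffOp_fallProd (σ : Fin d → ℝ) (β γ : ℝ) (k : Fin d → ℕ) (x : Fin d → ℝ) :
    diffOp σ β γ (fallProd k) x = eigenvalue σ β γ (∑ i, k i) * fallProd k x +
      ∑ i, (k i * ((k i - 1) * (γ - β - total σ - d - (∑ j, k j : ℕ)) -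
        (σ i + 1) * ((∑ j, k j : ℕ) - 1) - (γ - total σ - d) * (k i - 1) -
          (1 + β) * (1 + σ i)) : ℝ) * fallProd (predIdx k i) x := by
  have hk : eigenvalue σ β γ (∑ i, k i) * fallProd k x =
      ∑ i, (k i : ℝ) * ((-((∑ j, k j : ℕ) : ℝ) + γ - β - total σ - d) * fallProd k x) := by
    rw [eigenvalue, ← sum_mul]; push_cast; ring
  rw [diffOp, hk, ← sum_neg_distrib, ← sum_add_distrib, ← sum_add_distrib]
  refine sum_congr rfl fun i _ => ?_
  -- The operator `x_j ∇_j` is diagonal on falling products, so the sum over `j` only counts the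
  -- degree of `k - e_i`, apart from the term `j = i`.
  have h1 : ∑ j, x j * (σ i + 1 + x i + if i = j then γ - total σ - d else 0) *
        forwardDiff i (backwardDiff j (fallProd k)) x =
      k i * fallProd (predIdx k i) x * ((σ i + 1 + x i) * (∑ j, predIdx k i j : ℕ) +
        (γ - total σ - d) * predIdx k i i) := by
    have h2 : ∑ j, (if i = j then γ - total σ - d else 0) * (predIdx k i j : ℝ) =
        (γ - total σ - d) * predIdx k i i := by simp
    rw [← h2]
    push_cast
    rw [mul_sum, ← sum_add_distrib, mul_sum]
    refine sum_congr rfl fun j _ => ?_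
    linear_combination (σ i + 1 + x i + if i = j then γ - total σ - d else 0) *
      mul_forwardDiff_backwardDiff_fallProd k i j x
  rw [h1, forwardDiff_fallProd]
  by_cases h : k i = 0
  · simp [h]
  · have h3 := mul_fallProd_predIdx h x
    have h4 : ((∑ j, predIdx k i j : ℕ) : ℝ) = (∑ j, k j : ℕ) - 1 := by
      rw [← sum_predIdx h]; push_cast; ring
    have h5 : (predIdx k i i : ℝ) = k i - 1 := by
      rw [predIdx, Function.update_self, Nat.cast_sub (by omega)]; simp
    rw [h4, h5]
    linear_combination (k i : ℝ) * (γ - β - total σ - d - (∑ j, k j : ℕ)) * h3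

theorem diffOp_add (σ : Fin d → ℝ) (β γ : ℝ) (f g : (Fin d → ℝ) → ℝ) :
    diffOp σ β γ (f + g) = diffOp σ β γ f + diffOp σ β γ g := by
  funext x
  simp only [diffOp, forwardDiff, backwardDiff, Pi.add_apply]
  have (a b c e : ℝ) : -a + b + (-c + e) = -(a + c) + (b + e) := by ring
  rw [this, ← sum_add_distrib, ← sum_add_distrib]
  congr 2
  · refine sum_congr rfl fun i _ => ?_
    rw [← sum_add_distrib]
    exact sum_congr rfl fun j _ => by ring
  · exact funext fun i => by ring

theorem diffOp_smul (σ : Fin d → ℝ) (β γ c : ℝ) (f : (Fin d → ℝ) → ℝ) :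
    diffOp σ β γ (c • f) = c • diffOp σ β γ f := by
  funext x
  simp only [diffOp, forwardDiff, backwardDiff, Pi.smul_apply, smul_eq_mul, mul_add, mul_neg,
    mul_sum]
  congr 2
  · exact sum_congr rfl fun i _ => sum_congr rfl fun j _ => by ring
  · exact funext fun i => by ring

end Fall

/-! ### Polynomial functions of bounded total degree -/

/-- The functions on `ℝ^d` given by polynomials of total degree less than `n`. -/
noncomputable def polyLT (d n : ℕ) : Submodule ℝ ((Fin d → ℝ) → ℝ) :=
  Submodule.span ℝ {f | ∃ k : Fin d → ℕ, ∑ i, k i < n ∧ f = fallProd k}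

section PolyLT
variable {d : ℕ}

theorem fallProd_mem_polyLT {n : ℕ} {k : Fin d → ℕ} (h : ∑ i, k i < n) : fallProd k ∈ polyLT d n :=
  Submodule.subset_span ⟨k, h, rfl⟩

theorem polyLT_mono {m n : ℕ} (h : m ≤ n) : polyLT d m ≤ polyLT d n :=
  Submodule.span_mono fun _ ⟨k, hk, hf⟩ => ⟨k, hk.trans_le h, hf⟩

/-- All falling products of degree `n` share one eigenvalue modulo lower degree, so subtracting it
cancels the whole top part. -/
theorem diffOp_sub_mem_polyLT (σ : Fin d → ℝ) (β γ : ℝ) {n : ℕ} {f : (Fin d → ℝ) → ℝ}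
    (hf : f ∈ polyLT d (n + 1)) :
    diffOp σ β γ f - eigenvalue σ β γ n • f ∈ polyLT d n := by
  induction hf using Submodule.span_induction with
  | mem f hf =>
    obtain ⟨k, hk, rfl⟩ := hf
    have e : diffOp σ β γ (fallProd k) - eigenvalue σ β γ n • fallProd k =
        (eigenvalue σ β γ (∑ i, k i) - eigenvalue σ β γ n) • fallProd k +
      ∑ i, (k i * ((k i - 1) * (γ - β - total σ - d - (∑ j, k j : ℕ)) -
        (σ i + 1) * ((∑ j, k j : ℕ) - 1) - (γ - total σ - d) * (k i - 1) -
          (1 + β) * (1 + σ i)) : ℝ) • fallProd (predIdx k i) := by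
      funext x
      simp only [Pi.sub_apply, Pi.add_apply, Pi.smul_apply, Finset.sum_apply, smul_eq_mul,
        diffOp_fallProd]
      ring
    rw [e]
    refine Submodule.add_mem _ ?_ (Submodule.sum_mem _ fun i _ => ?_)
    · obtain h | h := (Nat.lt_succ_iff.1 hk).eq_or_lt
      · rw [h, sub_self, zero_smul]; exact Submodule.zero_mem _
      · exact Submodule.smul_mem _ _ (fallProd_mem_polyLT h)
    · by_cases h : k i = 0
      · simp [h]
      · have := sum_predIdx h
        exact Submodule.smul_mem _ _ (fallProd_mem_polyLT (by omega))
  | zero =>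
    have : diffOp σ β γ 0 = 0 := by
      have := diffOp_smul σ β γ 0 0
      simpa using this
    simp [this]
  | add f g _ _ hf hg =>
    rw [diffOp_add, smul_add, add_sub_add_comm]
    exact Submodule.add_mem _ hf hg
  | smul c f _ hf =>
    rw [diffOp_smul, smul_comm, ← smul_sub]
    exact Submodule.smul_mem _ _ hf

theorem mul_mem_polyLT {n : ℕ} (i : Fin d) {f : (Fin d → ℝ) → ℝ} (hf : f ∈ polyLT d n) :
    (fun x => x i * f x) ∈ polyLT d (n + 1) := by
  induction hf using Submodule.span_induction with
  | mem f hf =>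
    obtain ⟨k, hk, rfl⟩ := hf
    rw [funext fun x => mul_fallProd k i x]
    refine Submodule.add_mem _ (fallProd_mem_polyLT ?_)
      (Submodule.smul_mem _ (k i : ℝ) (fallProd_mem_polyLT (by omega)))
    rw [sum_update_succ]; omega
  | zero =>
    simp only [Pi.zero_apply, mul_zero]
    exact Submodule.zero_mem _
  | add f g _ _ hf hg =>
    simp only [Pi.add_apply, mul_add]
    exact Submodule.add_mem _ hf hg
  | smul c f _ hf =>
    convert Submodule.smul_mem _ c hf using 1
    funext x
    simp only [Pi.smul_apply, smul_eq_mul]; ring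

theorem monomial_mem_polyLT (m : Fin d → ℕ) :
    (fun x : Fin d → ℝ => ∏ i, x i ^ m i) ∈ polyLT d (∑ i, m i + 1) := by
  generalize hN : ∑ i, m i = N
  induction N generalizing m with
  | zero =>
    have h0 : ∀ i, m i = 0 := by simpa using hN
    have : (fun x : Fin d → ℝ => ∏ i, x i ^ m i) = fallProd (fun _ => 0) := by
      funext x; simp [h0, fallProd]
    rw [this]
    exact fallProd_mem_polyLT (by simp)
  | succ N ih =>
    obtain ⟨i, hi⟩ : ∃ i, m i ≠ 0 := by
      by_contra! h
      simp [h] at hN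
    have h1 := mul_mem_polyLT i (ih (predIdx m i) (by have := sum_predIdx hi; omega))
    convert h1 using 1
    funext x
    rw [← mul_prod_erase univ _ (mem_univ i), ← mul_prod_erase univ _ (mem_univ i), ← mul_assoc,
      ← pow_succ', predIdx, Function.update_self, Nat.sub_add_cancel (by omega)]
    congr 1
    refine prod_congr rfl fun j hj => ?_
    rw [Function.update_of_ne (ne_of_mem_erase hj)]

theorem eval_mem_polyLT {n : ℕ} {P : MvPolynomial (Fin d) ℝ} (hP : P.totalDegree ≤ n) :
    (fun x => MvPolynomial.eval x P) ∈ polyLT d (n + 1) := by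
  have : (fun x => MvPolynomial.eval x P) =
      ∑ m ∈ P.support, P.coeff m • fun x : Fin d → ℝ => ∏ i, x i ^ m i := by
    funext x
    simp [MvPolynomial.eval_eq', Finset.sum_apply]
  rw [this]
  refine Submodule.sum_mem _ fun m hm => Submodule.smul_mem _ _
    (polyLT_mono ?_ (monomial_mem_polyLT m))
  have := MvPolynomial.le_totalDegree hm
  rw [Finsupp.sum_fintype _ _ (by simp)] at this
  omega

/-- `f` is given by a polynomial of total degree at most `n`. -/
def IsPolyLE (n : ℕ) (f : (Fin d → ℝ) → ℝ) : Prop :=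
  ∃ P : MvPolynomial (Fin d) ℝ, P.totalDegree ≤ n ∧ ∀ x, MvPolynomial.eval x P = f x

theorem IsPolyLE.mono {m n : ℕ} (h : m ≤ n) {f : (Fin d → ℝ) → ℝ} (hf : IsPolyLE m f) :
    IsPolyLE n f := by
  obtain ⟨P, hP, h1⟩ := hf
  exact ⟨P, hP.trans h, h1⟩

theorem IsPolyLE.const (n : ℕ) (c : ℝ) : IsPolyLE n (fun _ : Fin d → ℝ => c) :=
  ⟨MvPolynomial.C c, by simp, by simp⟩

theorem IsPolyLE.coord (i : Fin d) : IsPolyLE 1 (fun x : Fin d → ℝ => x i) :=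
  ⟨MvPolynomial.X i, by simp, by simp⟩

theorem IsPolyLE.add {n : ℕ} {f g : (Fin d → ℝ) → ℝ} (hf : IsPolyLE n f) (hg : IsPolyLE n g) :
    IsPolyLE n (fun x => f x + g x) := by
  obtain ⟨P, hP, h1⟩ := hf
  obtain ⟨Q, hQ, h2⟩ := hg
  exact ⟨P + Q, (MvPolynomial.totalDegree_add _ _).trans (max_le hP hQ), fun x => by simp [h1, h2]⟩

theorem IsPolyLE.mul {m n : ℕ} {f g : (Fin d → ℝ) → ℝ} (hf : IsPolyLE m f) (hg : IsPolyLE n g) :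
    IsPolyLE (m + n) (fun x => f x * g x) := by
  obtain ⟨P, hP, h1⟩ := hf
  obtain ⟨Q, hQ, h2⟩ := hg
  exact ⟨P * Q, (MvPolynomial.totalDegree_mul _ _).trans (add_le_add hP hQ),
    fun x => by simp [h1, h2]⟩

theorem IsPolyLE.sum {ι : Type*} {n : ℕ} {s : Finset ι} {f : ι → (Fin d → ℝ) → ℝ}
    (hf : ∀ i ∈ s, IsPolyLE n (f i)) : IsPolyLE n (fun x => ∑ i ∈ s, f i x) := by
  classical
  induction s using Finset.induction_on with
  | empty => simpa using IsPolyLE.const n 0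
  | insert a s ha ih =>
    simp only [sum_insert ha]
    exact (hf a (mem_insert_self _ _)).add (ih fun i hi => hf i (mem_insert_of_mem hi))

theorem IsPolyLE.prod {ι : Type*} {s : Finset ι} {n : ι → ℕ} {f : ι → (Fin d → ℝ) → ℝ}
    (hf : ∀ i ∈ s, IsPolyLE (n i) (f i)) : IsPolyLE (∑ i ∈ s, n i) (fun x => ∏ i ∈ s, f i x) := by
  classical
  induction s using Finset.induction_on with
  | empty => simpa using IsPolyLE.const 0 1
  | insert a s ha ih =>
    simp only [sum_insert ha, prod_insert ha]
    exact (hf a (mem_insert_self _ _)).mul (ih fun i hi => hf i (mem_insert_of_mem hi))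

theorem IsPolyLE.poch {f : (Fin d → ℝ) → ℝ} (hf : IsPolyLE 1 f) (k : ℕ) :
    IsPolyLE k (fun x => poch (f x) k) := by
  simp only [poch_eq_prod]
  have := IsPolyLE.prod (s := range k) (n := fun _ => 1) (f := fun j x => f x + j)
    fun j _ => hf.add (IsPolyLE.const 1 (j : ℝ))
  simpa using this

theorem IsPolyLE.mem_polyLT {n : ℕ} {f : (Fin d → ℝ) → ℝ} (hf : IsPolyLE n f) :
    f ∈ polyLT d (n + 1) := by
  obtain ⟨P, hP, h1⟩ := hf
  rw [← funext h1]
  exact eval_mem_polyLT hP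

theorem IsPolyLE.const_mul {n : ℕ} {f : (Fin d → ℝ) → ℝ} (c : ℝ) (hf : IsPolyLE n f) :
    IsPolyLE n (fun x => c * f x) := by
  have := (IsPolyLE.const 0 c).mul hf
  rwa [zero_add] at this

theorem IsPolyLE.sub {n : ℕ} {f g : (Fin d → ℝ) → ℝ} (hf : IsPolyLE n f) (hg : IsPolyLE n g) :
    IsPolyLE n (fun x => f x - g x) := by
  convert hf.add (hg.const_mul (-1)) using 1
  funext x; ring

theorem isPolyLE_fallProd_add (k : Fin d → ℕ) (v : Fin d → ℝ) :
    IsPolyLE (∑ i, k i) (fun x => fallProd k (x + v)) := by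
  refine IsPolyLE.prod fun i _ => ?_
  have h := ((((IsPolyLE.coord i).add (IsPolyLE.const 1 (v i))).const_mul (-1)).poch (k i)).const_mul
    ((-1 : ℝ) ^ k i)
  convert h using 1
  funext x
  rw [_root_.poch, neg_one_mul, ascPochhammer_eval_neg_eq_descPochhammer, ← mul_assoc, ← mul_pow]
  simp

theorem isPolyLE_fallProd (k : Fin d → ℕ) : IsPolyLE (∑ i, k i) (fallProd k) := by
  simpa using isPolyLE_fallProd_add k 0

theorem isPolyLE_of_mem_polyLT {n : ℕ} {f : (Fin d → ℝ) → ℝ} (hf : f ∈ polyLT d (n + 1)) :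
    IsPolyLE n f := by
  induction hf using Submodule.span_induction with
  | mem f hf =>
    obtain ⟨k, hk, rfl⟩ := hf
    exact (isPolyLE_fallProd k).mono (by omega)
  | zero => exact IsPolyLE.const n 0
  | add f g _ _ hf hg => exact hf.add hg
  | smul c f _ hf => exact hf.const_mul c

theorem isPolyLE_iff_mem_polyLT {n : ℕ} {f : (Fin d → ℝ) → ℝ} :
    IsPolyLE n f ↔ f ∈ polyLT d (n + 1) :=
  ⟨IsPolyLE.mem_polyLT, isPolyLE_of_mem_polyLT⟩

theorem IsPolyLE.comp_add {n : ℕ} {f : (Fin d → ℝ) → ℝ} (hf : IsPolyLE n f) (v : Fin d → ℝ) :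
    IsPolyLE n (fun x => f (x + v)) := by
  rw [isPolyLE_iff_mem_polyLT] at hf
  induction hf using Submodule.span_induction with
  | mem f hf =>
    obtain ⟨k, hk, rfl⟩ := hf
    exact (isPolyLE_fallProd_add k v).mono (by omega)
  | zero => exact IsPolyLE.const n 0
  | add f g _ _ hf hg => exact hf.add hg
  | smul c f _ hf => exact hf.const_mul c

/-- A polynomial function vanishing on the lattice `ℕ^d` vanishes. -/
theorem eq_zero_of_mem_polyLT {n : ℕ} {f : (Fin d → ℝ) → ℝ} (hf : f ∈ polyLT d n)
    (h : ∀ x : Fin d → ℕ, f (toReal x) = 0) : f = 0 := by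
  obtain ⟨P, -, hP⟩ := isPolyLE_of_mem_polyLT (polyLT_mono (Nat.le_succ n) hf)
  have : P = 0 := by
    refine MvPolynomial.funext_set (fun _ => Set.range ((↑) : ℕ → ℝ))
      (fun _ => Set.infinite_range_of_injective Nat.cast_injective) fun x hx => ?_
    choose y hy using fun i => hx i (Set.mem_univ i)
    have : x = toReal y := funext fun i => (hy i).symm
    rw [this, hP, h, map_zero]
  funext x
  rw [← hP, this, map_zero]; rfl

end PolyLT

/-! ### Symmetry of the operator with respect to the weight -/

section Adjoint
variable {d : ℕ}

theorem multiR_zero (σ : Fin d → ℝ) (β γ : ℝ) (x : Fin d → ℝ) : multiR σ β γ 0 x = 1 := by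
  simp [multiR, oneVarR, poch_zero]

theorem summable_weight {σ : Fin d → ℝ} {β γ : ℝ} (hσ : ∀ i, -1 < σ i) (hβ : -1 < β)
    (h : 0 < γ - total σ - β - d) : Summable (weight σ β γ) := by
  have h0 : 2 * total (toReal (0 : Fin d → ℕ)) < γ - total σ - β - d := by
    simpa [total, toReal] using h
  simpa [multiR_zero] using (hasSum_multiR_mul hσ hβ h0 h0).summable

/-- A factor growing like `|x|^N` is absorbed by raising `β` to `β + N`. Summability of the shifted
weight thus handles polynomials of degree `N`. -/
theorem poch_mul_weight (σ : Fin d → ℝ) (β γ : ℝ) (N : ℕ) (x : Fin d → ℕ) :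
    poch (β + 1 + (∑ i, x i : ℕ)) N * weight σ β γ x =
      poch (β + 1) N * weight σ (β + N) γ x := by
  have h : poch (β + 1) (∑ i, x i) * poch (β + 1 + (∑ i, x i : ℕ)) N =
      poch (β + 1) N * poch (β + N + 1) (∑ i, x i) := by
    rw [← poch_add, add_comm (∑ i, x i), poch_add]
    congr 2; ring
  unfold weight
  linear_combination (∏ i, poch (σ i + 1) (x i) / ((x i).factorial : ℝ)) /
    poch (γ + 1) (∑ i, x i) * h

theorem pow_le_poch {β : ℝ} (hβ : -1 < β) (N s : ℕ) :
    min 1 (β + 1) ^ N * ((s : ℝ) + 1) ^ N ≤ poch (β + 1 + s) N := by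
  have h0 : 0 < min 1 (β + 1) := lt_min one_pos (by linarith)
  rw [← mul_pow, poch_eq_prod, ← card_range N, ← prod_const, card_range]
  refine prod_le_prod (fun k _ => by positivity) fun k _ => ?_
  have h1 : min 1 (β + 1) ≤ 1 := min_le_left _ _
  have h2 : min 1 (β + 1) ≤ β + 1 := min_le_right _ _
  have hs : (0 : ℝ) ≤ s := by positivity
  have hk : (0 : ℝ) ≤ k := by positivity
  -- Each factor satisfies `min 1 (β + 1) * (s + 1) ≤ s + (β + 1) ≤ β + 1 + s + k`.
  nlinarith

theorem abs_fallProd_le {k : Fin d → ℕ} {N : ℕ} (hk : ∑ i, k i ≤ N) (x : Fin d → ℕ) :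
    |fallProd k (toReal x)| ≤ ((∑ i, x i : ℕ) + 1 : ℝ) ^ N := by
  have h1 : fallProd k (toReal x) = ((∏ i, (x i).descFactorial (k i) : ℕ) : ℝ) := by
    simp [fallProd, toReal, descPochhammer_eval_eq_descFactorial]
  rw [h1, abs_of_nonneg (by positivity)]
  have h2 : ∏ i, (x i).descFactorial (k i) ≤ (∑ i, x i + 1) ^ N :=
    calc ∏ i, (x i).descFactorial (k i) ≤ ∏ i, (∑ i, x i + 1) ^ k i := by
          refine prod_le_prod' fun i _ => (Nat.descFactorial_le_pow _ _).trans
            (Nat.pow_le_pow_left ?_ _)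
          exact (single_le_sum (fun _ _ => Nat.zero_le _) (mem_univ i)).trans (Nat.le_succ _)
      _ = (∑ i, x i + 1) ^ ∑ i, k i := by rw [prod_pow_eq_pow_sum]
      _ ≤ _ := Nat.pow_le_pow_right (by omega) hk
  exact_mod_cast h2

theorem summable_mul_weight {σ : Fin d → ℝ} {β γ : ℝ} (hσ : ∀ i, -1 < σ i) (hβ : -1 < β) {N : ℕ}
    (h : N < γ - total σ - β - d) {f : (Fin d → ℝ) → ℝ} (hf : IsPolyLE N f) :
    Summable fun x : Fin d → ℕ => weight σ β γ x * f (toReal x) := by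
  have hS := total_add_card_nonneg hσ
  have hN : (0 : ℝ) ≤ N := by positivity
  rw [isPolyLE_iff_mem_polyLT] at hf
  induction hf using Submodule.span_induction with
  | mem f hf =>
    obtain ⟨k, hk, rfl⟩ := hf
    have h0 : 0 < min 1 (β + 1) := lt_min one_pos (by linarith)
    have hs := (summable_weight (β := β + N) (γ := γ) hσ (by linarith) (by linarith)).mul_left
      (poch (β + 1) N / min 1 (β + 1) ^ N)
    refine Summable.of_norm_bounded hs fun x => ?_
    have hw := weight_pos hσ hβ (show -1 < γ by linarith) x
    rw [Real.norm_eq_abs, abs_mul, abs_of_pos hw, div_mul_eq_mul_div, ← poch_mul_weight,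
      le_div_iff₀ (by positivity)]
    have h1 := abs_fallProd_le (Nat.lt_succ_iff.1 hk) x
    have h2 := pow_le_poch hβ N (∑ i, x i)
    calc weight σ β γ x * |fallProd k (toReal x)| * min 1 (β + 1) ^ N
        ≤ weight σ β γ x * ((∑ i, x i : ℕ) + 1 : ℝ) ^ N * min 1 (β + 1) ^ N := by gcongr
      _ = min 1 (β + 1) ^ N * ((∑ i, x i : ℕ) + 1 : ℝ) ^ N * weight σ β γ x := by ring
      _ ≤ _ := by gcongr
  | zero => simp [summable_zero]
  | add f g _ _ hf hg => simpa [mul_add] using hf.add hg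
  | smul c f _ hf =>
    refine (hf.mul_left c).congr fun x => ?_
    simp only [Pi.smul_apply, smul_eq_mul]; ring

/-- Writes `D` as a combination of differences along the edges `x → x + e_i - e_j`, `x → x + e_i`
and `x → x - e_i`, so that symmetry can be checked edge by edge. The jumps with `i = j` contribute
nothing. -/
theorem diffOp_eq_edges (σ : Fin d → ℝ) (β γ : ℝ) (f : (Fin d → ℝ) → ℝ) (x : Fin d → ℝ) :
    diffOp σ β γ f x =
      ∑ i, ∑ j, x j * (σ i + 1 + x i) * (f (x + Pi.single i 1 - Pi.single j 1) - f x) -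
      ∑ i, (total x + β + 1) * (σ i + 1 + x i) * (f (x + Pi.single i 1) - f x) -
      ∑ i, x i * (total x + γ) * (f (x - Pi.single i 1) - f x) := by
  have h1 : ∑ i, ∑ j, x j * (σ i + 1 + x i + if i = j then γ - total σ - d else 0) *
        forwardDiff i (backwardDiff j f) x =
      ∑ i, total x * ((σ i + 1 + x i) * (f (x + Pi.single i 1) - f x)) -
      ∑ i, ∑ j, x j * (σ i + 1 + x i) * (f (x + Pi.single i 1 - Pi.single j 1) - f x) +
      ∑ j, (total σ + d + total x) * (x j * (f (x - Pi.single j 1) - f x)) +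
      ∑ i, x i * (γ - total σ - d) * ((f (x + Pi.single i 1) - f x) +
        (f (x - Pi.single i 1) - f x)) := by
    have e1 : ∑ i, total x * ((σ i + 1 + x i) * (f (x + Pi.single i 1) - f x)) =
        ∑ i, ∑ j, x j * ((σ i + 1 + x i) * (f (x + Pi.single i 1) - f x)) := by
      simp only [total, sum_mul]
    have e2 : ∑ j, (total σ + d + total x) * (x j * (f (x - Pi.single j 1) - f x)) =
        ∑ i, ∑ j, (σ i + 1 + x i) * (x j * (f (x - Pi.single j 1) - f x)) := by
      have : total σ + d + total x = ∑ i, (σ i + 1 + x i) := by simp [total, sum_add_distrib]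
      simp only [this, sum_mul]
      rw [sum_comm]
    have e3 : ∑ i, x i * (γ - total σ - d) * ((f (x + Pi.single i 1) - f x) +
        (f (x - Pi.single i 1) - f x)) = ∑ i, ∑ j, if i = j then x j * (γ - total σ - d) *
          ((f (x + Pi.single i 1) - f x) + (f (x - Pi.single j 1) - f x)) else 0 := by
      simp
    rw [e1, e2, e3, ← sum_sub_distrib, ← sum_add_distrib, ← sum_add_distrib]
    refine sum_congr rfl fun i _ => ?_
    rw [← sum_sub_distrib, ← sum_add_distrib, ← sum_add_distrib]
    refine sum_congr rfl fun j _ => ?_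
    simp only [forwardDiff, backwardDiff]
    split_ifs with hij
    · subst hij
      rw [add_sub_cancel_right]; ring
    · ring
  rw [diffOp, h1]
  have h2 : ∑ i, (x i * (γ - β - total σ - d - 1) - (1 + β) * (1 + σ i)) * forwardDiff i f x =
      ∑ i, total x * ((σ i + 1 + x i) * (f (x + Pi.single i 1) - f x)) +
      ∑ i, x i * (γ - total σ - d) * ((f (x + Pi.single i 1) - f x) +
        (f (x - Pi.single i 1) - f x)) +
      ∑ j, (total σ + d + total x) * (x j * (f (x - Pi.single j 1) - f x)) -
      ∑ i, (total x + β + 1) * (σ i + 1 + x i) * (f (x + Pi.single i 1) - f x) -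
      ∑ i, x i * (total x + γ) * (f (x - Pi.single i 1) - f x) := by
    rw [← sum_add_distrib, ← sum_add_distrib, ← sum_sub_distrib, ← sum_sub_distrib]
    refine sum_congr rfl fun i _ => ?_
    simp only [forwardDiff]
    ring
  rw [h2]
  ring

theorem toReal_add_single (x : Fin d → ℕ) (i : Fin d) :
    toReal (x + Pi.single i 1) = toReal x + Pi.single i 1 := by
  funext j
  by_cases h : j = i
  · subst h; simp [toReal]
  · simp [toReal, h]

theorem total_add_single (x : Fin d → ℝ) (i : Fin d) :
    total (x + Pi.single i 1) = total x + 1 := by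
  simp [total, sum_add_distrib]

/-- Detailed balance for the weight. -/
theorem weight_add_single {σ : Fin d → ℝ} {β γ : ℝ} (hγ : -1 < γ) (x : Fin d → ℕ) (i : Fin d) :
    weight σ β γ (x + Pi.single i 1) * ((x i + 1) * (total (toReal x) + 1 + γ)) =
      weight σ β γ x * ((total (toReal x) + β + 1) * (σ i + 1 + x i)) := by
  have hs : ∑ j, (x + Pi.single i 1 : Fin d → ℕ) j = ∑ j, x j + 1 := by
    simp [sum_add_distrib]
  have hp : ∏ j ∈ univ.erase i, poch (σ j + 1) ((x + Pi.single i 1 : Fin d → ℕ) j) /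
      (((x + Pi.single i 1 : Fin d → ℕ) j).factorial : ℝ) =
      ∏ j ∈ univ.erase i, poch (σ j + 1) (x j) / ((x j).factorial : ℝ) := by
    refine prod_congr rfl fun j hj => ?_
    rw [Pi.add_apply, Pi.single_eq_of_ne (ne_of_mem_erase hj), add_zero]
  have hT := total_toReal_nonneg x
  rw [weight, weight, hs, ← mul_prod_erase univ _ (mem_univ i), hp,
    ← mul_prod_erase univ (fun j => poch (σ j + 1) (x j) / ((x j).factorial : ℝ)) (mem_univ i),
    Pi.add_apply, Pi.single_eq_same, poch_succ, poch_succ, poch_succ, Nat.factorial_succ,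
    ← total_toReal]
  have h1 := (poch_pos (a := γ + 1) (by linarith) (∑ j, x j)).ne'
  have h2 : γ + 1 + total (toReal x) ≠ 0 := by linarith
  push_cast
  generalize (∏ j ∈ univ.erase i, _ : ℝ) = Q
  field_simp
  ring

/-- The translate by `e_i` misses only the points with `x i = 0`, where the flux coefficients `x i`
vanish: there are no boundary terms. -/
theorem hasSum_of_hasSum_add_single {F : (Fin d → ℕ) → ℝ} {a : ℝ} (i : Fin d)
    (h0 : ∀ x, x i = 0 → F x = 0) (h : HasSum (fun x : Fin d → ℕ => F (x + Pi.single i 1)) a) :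
    HasSum F a := by
  refine (Function.Injective.hasSum_iff (add_left_injective (Pi.single i 1 : Fin d → ℕ)) ?_).1 h
  intro x hx
  refine h0 x (by_contra fun hi => hx ⟨predIdx x i, ?_⟩)
  funext j
  by_cases hj : j = i
  · subst hj; simp [predIdx]; omega
  · simp [predIdx, hj]

theorem hasSum_add_single {F : (Fin d → ℕ) → ℝ} (i : Fin d)
    (h0 : ∀ x, x i = 0 → F x = 0) (hF : Summable F) :
    HasSum (fun x : Fin d → ℕ => F (x + Pi.single i 1)) (∑' x, F x) := by
  have h1 := (hF.comp_injective (add_left_injective (Pi.single i 1 : Fin d → ℕ))).hasSum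
  rw [(hasSum_of_hasSum_add_single i h0 h1).tsum_eq]
  exact h1

/-- The antisymmetrized flux of `diffOp` along the edges `x → x + e_i - e_j`. -/
noncomputable def jumpFlux (σ : Fin d → ℝ) (β γ : ℝ) (f g : (Fin d → ℝ) → ℝ) (i j : Fin d)
    (x : Fin d → ℕ) : ℝ :=
  weight σ β γ x * (x j * (σ i + 1 + x i) *
    (f (toReal x + Pi.single i 1 - Pi.single j 1) * g (toReal x) -
      f (toReal x) * g (toReal x + Pi.single i 1 - Pi.single j 1)))

/-- The antisymmetrized flux of `diffOp` along the edges `x → x + e_i`. -/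
noncomputable def upFlux (σ : Fin d → ℝ) (β γ : ℝ) (f g : (Fin d → ℝ) → ℝ) (i : Fin d)
    (x : Fin d → ℕ) : ℝ :=
  weight σ β γ x * ((total (toReal x) + β + 1) * (σ i + 1 + x i) *
    (f (toReal x + Pi.single i 1) * g (toReal x) - f (toReal x) * g (toReal x + Pi.single i 1)))

/-- The antisymmetrized flux of `diffOp` along the edges `x → x - e_i`. -/
noncomputable def downFlux (σ : Fin d → ℝ) (β γ : ℝ) (f g : (Fin d → ℝ) → ℝ) (i : Fin d)
    (x : Fin d → ℕ) : ℝ :=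
  weight σ β γ x * (x i * (total (toReal x) + γ) *
    (f (toReal x - Pi.single i 1) * g (toReal x) - f (toReal x) * g (toReal x - Pi.single i 1)))

theorem diffOp_commutator_eq (σ : Fin d → ℝ) (β γ : ℝ) (f g : (Fin d → ℝ) → ℝ) (x : Fin d → ℕ) :
    weight σ β γ x * (diffOp σ β γ f (toReal x) * g (toReal x) -
        f (toReal x) * diffOp σ β γ g (toReal x)) =
      ∑ i, ∑ j, jumpFlux σ β γ f g i j x - ∑ i, upFlux σ β γ f g i x -
        ∑ i, downFlux σ β γ f g i x := by
  have e : ∀ i, toReal x i = x i := fun i => rfl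
  simp only [diffOp_eq_edges, e, jumpFlux, upFlux, downFlux]
  simp only [← mul_sum, ← mul_sub]
  congr 1
  simp only [sub_mul, mul_sub (f (toReal x)), sum_mul, mul_sum]
  have (p q r s t u : ℝ) : p - q - r - (s - t - u) = (p - s) - (q - t) - (r - u) := by ring
  rw [this]
  simp only [← sum_sub_distrib]
  refine sum_congr rfl fun i _ => ?_
  congr 1
  · congr 1
    · exact sum_congr rfl fun j _ => by ring
    · ring
  · ring

theorem downFlux_add_single {σ : Fin d → ℝ} {β γ : ℝ} (hγ : -1 < γ) (f g : (Fin d → ℝ) → ℝ)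
    (i : Fin d) (x : Fin d → ℕ) :
    downFlux σ β γ f g i (x + Pi.single i 1) = -upFlux σ β γ f g i x := by
  rw [downFlux, upFlux, toReal_add_single, total_add_single, add_sub_cancel_right, Pi.add_apply,
    Pi.single_eq_same]
  push_cast
  linear_combination (f (toReal x) * g (toReal x + Pi.single i 1) -
    f (toReal x + Pi.single i 1) * g (toReal x)) * weight_add_single (σ := σ) (β := β) hγ x i

/-- Based at the common point `z = x - e_j`, the prefactor is symmetric in `i` and `j` while the
bracket is antisymmetric. Hence opposite jumps cancel in total. -/
theorem jumpFlux_add_single {σ : Fin d → ℝ} {β γ : ℝ} (hγ : -1 < γ) (f g : (Fin d → ℝ) → ℝ)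
    {i j : Fin d} (hij : i ≠ j) (z : Fin d → ℕ) :
    jumpFlux σ β γ f g i j (z + Pi.single j 1) =
      weight σ β γ z * ((total (toReal z) + β + 1) / (total (toReal z) + 1 + γ)) *
        ((σ i + 1 + z i) * (σ j + 1 + z j)) *
        (f (toReal z + Pi.single i 1) * g (toReal z + Pi.single j 1) -
          f (toReal z + Pi.single j 1) * g (toReal z + Pi.single i 1)) := by
  have hT := total_toReal_nonneg z
  have h2 : total (toReal z) + 1 + γ ≠ 0 := by linarith
  rw [jumpFlux, toReal_add_single, show toReal z + Pi.single j 1 + Pi.single i 1 -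
    Pi.single j (1 : ℝ) = toReal z + Pi.single i 1 by abel, Pi.add_apply, Pi.add_apply,
    Pi.single_eq_same, Pi.single_eq_of_ne hij]
  have h3 := weight_add_single (σ := σ) (β := β) hγ z j
  push_cast
  field_simp
  linear_combination (σ i + 1 + z i) * (f (toReal z + Pi.single i 1) *
    g (toReal z + Pi.single j 1) - f (toReal z + Pi.single j 1) *
      g (toReal z + Pi.single i 1)) * h3

theorem tsum_jumpFlux_antisymm {σ : Fin d → ℝ} {β γ : ℝ} (hγ : -1 < γ) {f g : (Fin d → ℝ) → ℝ}
    (h : ∀ i j, Summable (jumpFlux σ β γ f g i j)) (i j : Fin d) :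
    ∑' x, jumpFlux σ β γ f g i j x = -∑' x, jumpFlux σ β γ f g j i x := by
  by_cases hij : i = j
  · subst hij
    have : ∀ x, jumpFlux σ β γ f g i i x = 0 := fun x => by simp [jumpFlux]
    simp [this]
  · have hs (i j : Fin d) := hasSum_add_single (F := jumpFlux σ β γ f g i j) j
      (fun x hx => by simp [jumpFlux, hx]) (h i j)
    refine (hs i j).unique (hasSum_of_eq (hs j i).neg (fun z => ?_) rfl)
    rw [jumpFlux_add_single hγ f g hij, jumpFlux_add_single hγ f g (Ne.symm hij)]
    ring

/-- `diffOp` is symmetric with respect to the weight. -/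
theorem hasSum_diffOp_symm {σ : Fin d → ℝ} {β γ : ℝ} (hσ : ∀ i, -1 < σ i) (hβ : -1 < β) {a b : ℕ}
    (h : ((a + b + 2 : ℕ) : ℝ) < γ - total σ - β - d) {f g : (Fin d → ℝ) → ℝ}
    (hf : IsPolyLE a f) (hg : IsPolyLE b g) :
    HasSum (fun x : Fin d → ℕ => weight σ β γ x *
      (diffOp σ β γ f (toReal x) * g (toReal x) - f (toReal x) * diffOp σ β γ g (toReal x))) 0 := by
  have hS := total_add_card_nonneg hσ
  have hN : (0 : ℝ) ≤ ((a + b + 2 : ℕ) : ℝ) := by positivity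
  have hγ : -1 < γ := by linarith
  have hcoord (i : Fin d) (c : ℝ) : IsPolyLE 1 (fun x : Fin d → ℝ => c + x i) :=
    (IsPolyLE.const 1 c).add (IsPolyLE.coord i)
  have htot (c : ℝ) : IsPolyLE 1 (fun x : Fin d → ℝ => total x + c) :=
    (IsPolyLE.sum fun i _ => IsPolyLE.coord i).add (IsPolyLE.const 1 c)
  have hcomm (v : Fin d → ℝ) : IsPolyLE (a + b) (fun x => f (x + v) * g x - f x * g (x + v)) :=
    ((hf.comp_add v).mul hg).sub (hf.mul (hg.comp_add v))
  -- Each flux is the weight times a polynomial of degree at most `a + b + 2`: two from the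
  -- coefficient, the rest from `f` and `g`. This is where `h` comes from.
  have hL (i j : Fin d) : Summable (jumpFlux σ β γ f g i j) := by
    have := summable_mul_weight hσ hβ h (((((IsPolyLE.coord j).mul (hcoord i (σ i + 1))).mul
      (hcomm (Pi.single i 1 - Pi.single j 1))).mono (by omega)))
    simp only [← add_sub_assoc] at this
    exact this
  have hK (i : Fin d) : Summable (upFlux σ β γ f g i) := by
    have := summable_mul_weight hσ hβ h (((((htot (β + 1)).mul (hcoord i (σ i + 1))).mul
      (hcomm (Pi.single i 1))).mono (by omega)))
    simp only [← add_assoc] at this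
    exact this
  have hM (i : Fin d) : HasSum (downFlux σ β γ f g i) (-∑' x, upFlux σ β γ f g i x) :=
    hasSum_of_hasSum_add_single i (fun x hx => by simp [downFlux, hx])
      (hasSum_of_eq (hK i).hasSum.neg (downFlux_add_single hγ f g i) rfl)
  have hS0 : ∑ i, ∑ j, ∑' x, jumpFlux σ β γ f g i j x = 0 := by
    have h1 : ∑ i, ∑ j, ∑' x, jumpFlux σ β γ f g i j x =
        ∑ i, ∑ j, -∑' x, jumpFlux σ β γ f g i j x := by
      rw [sum_comm]
      exact sum_congr rfl fun i _ => sum_congr rfl fun j _ => tsum_jumpFlux_antisymm hγ hL _ _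
    simp only [sum_neg_distrib] at h1
    linarith
  refine hasSum_of_eq (((hasSum_sum (s := univ) fun i _ => hasSum_sum (s := univ) fun j _ =>
    (hL i j).hasSum).sub (hasSum_sum (s := univ) fun i _ => (hK i).hasSum)).sub
      (hasSum_sum (s := univ) fun i _ => hM i)) (diffOp_commutator_eq σ β γ f g) ?_
  rw [hS0, sum_neg_distrib]
  ring

end Adjoint

/-! ### The polynomials `R_ν` and their eigenvalue equation -/

section Poly
variable {d : ℕ}

/-- The polynomial `R_ν` with the denominators `(α_{2,j} + 1)_k` cancelled. -/
noncomputable def polyR (σ : Fin d → ℝ) (β γ : ℝ) (ν : Fin d → ℕ) (x : Fin d → ℝ) : ℝ :=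
  ∏ i : Fin d, ∑ k ∈ range (ν i + 1),
    poch (-(ν i : ℝ)) k * poch (ν i - alphaGap σ β γ ν (i.val + 1) + σ i + 1) k /
      (poch (σ i + 1) k * (k.factorial : ℝ)) *
      (poch (-x i) k * poch (alpha2 β ν x (i.val + 1) + 1 + k) (ν i - k))

/-- The prefactor `(α_{2,j} + 1)_{ν_j}` contains each denominator `(α_{2,j} + 1)_k` and leaves
`(α_{2,j} + 1 + k)_{ν_j - k}`. -/
theorem multiR_eq_polyR (σ : Fin d → ℝ) (β γ : ℝ) (ν : Fin d → ℕ) (x : Fin d → ℝ)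
    (h : ∀ i : Fin d, poch (alpha2 β ν x (i.val + 1) + 1) (ν i) ≠ 0) :
    multiR σ β γ ν x = polyR σ β γ ν x := by
  refine prod_congr rfl fun i _ => ?_
  rw [oneVarR, mul_sum]
  refine sum_congr rfl fun k hk => ?_
  have hk : k ≤ ν i := by simpa [Nat.lt_succ_iff] using hk
  have h1 : poch (alpha2 β ν x (i.val + 1) + 1) (ν i) =
      poch (alpha2 β ν x (i.val + 1) + 1) k *
        poch (alpha2 β ν x (i.val + 1) + 1 + k) (ν i - k) := by
    rw [← poch_add, Nat.add_sub_cancel' hk]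
  have h2 : poch (alpha2 β ν x (i.val + 1) + 1) k ≠ 0 := fun h0 => h i (by rw [h1, h0, zero_mul])
  rw [h1, ← alpha3_sub_alpha2 σ β γ ν x, show (ν i : ℝ) - alpha3 σ γ ν x (i.val + 1) + σ i +
    alpha2 β ν x (i.val + 1) + 1 = ν i - (alpha3 σ γ ν x (i.val + 1) -
      alpha2 β ν x (i.val + 1)) + σ i + 1 by ring]
  generalize poch (ν i - (alpha3 σ γ ν x (i.val + 1) - alpha2 β ν x (i.val + 1)) + σ i + 1) k = q
  generalize poch (alpha2 β ν x (i.val + 1) + 1 + k) (ν i - k) = r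
  generalize poch (alpha2 β ν x (i.val + 1) + 1) k = s at *
  -- The lemma does not bound `σ` below; if this symbol vanishes, both sides are zero since division
  -- by zero gives zero.
  by_cases h3 : poch (σ i + 1) k = 0
  · simp [h3]
  · field_simp

theorem isPolyLE_polyR (σ : Fin d → ℝ) (β γ : ℝ) (ν : Fin d → ℕ) :
    IsPolyLE (∑ i, ν i) (polyR σ β γ ν) := by
  refine IsPolyLE.prod fun i _ => IsPolyLE.sum fun k hk => IsPolyLE.const_mul _ ?_
  have hk : k ≤ ν i := by simpa [Nat.lt_succ_iff] using hk
  have h1 : IsPolyLE 1 (fun x : Fin d → ℝ => -x i) := by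
    simpa using (IsPolyLE.coord i).const_mul (-1)
  have h2 : IsPolyLE 1 (fun x : Fin d → ℝ => alpha2 β ν x (i.val + 1) + 1 + k) :=
    (((IsPolyLE.const 1 _).add (IsPolyLE.sum fun j _ => IsPolyLE.coord j)).add
      (IsPolyLE.const 1 1)).add (IsPolyLE.const 1 (k : ℝ))
  have := (h1.poch k).mul (h2.poch (ν i - k))
  rwa [Nat.add_sub_cancel' hk] at this

theorem poch_alpha2_pos {β : ℝ} (hβ : -1 < β) (ν x : Fin d → ℕ) (j n : ℕ) :
    0 < poch (alpha2 β ν (toReal x) j + 1) n := by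
  refine poch_pos ?_ n
  have h1 : 0 ≤ tailSum (toReal ν) (j + 1) := sum_nonneg fun _ _ => Nat.cast_nonneg _
  have h2 : 0 ≤ headSum (toReal x) (j - 1) := sum_nonneg fun _ _ => Nat.cast_nonneg _
  unfold alpha2
  linarith

theorem multiR_toReal {β : ℝ} (hβ : -1 < β) (σ : Fin d → ℝ) (γ : ℝ) (ν x : Fin d → ℕ) :
    multiR σ β γ ν (toReal x) = polyR σ β γ ν (toReal x) :=
  multiR_eq_polyR σ β γ ν _ fun _ => (poch_alpha2_pos hβ ν x _ _).ne'

theorem hasSum_polyR_mul {σ : Fin d → ℝ} {β γ : ℝ} (hσ : ∀ i, -1 < σ i)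
    (hβ : -1 < β) {ν μ : Fin d → ℕ}
    (hν : 2 * ((∑ i, ν i : ℕ) : ℝ) < γ - total σ - β - d)
    (hμ : 2 * ((∑ i, μ i : ℕ) : ℝ) < γ - total σ - β - d) :
    HasSum (fun x : Fin d → ℕ => weight σ β γ x *
        (polyR σ β γ ν (toReal x) * polyR σ β γ μ (toReal x)))
      (if ν = μ then normA σ β γ ν else 0) := by
  rw [← total_toReal] at hν hμ
  refine hasSum_of_eq (hasSum_multiR_mul hσ hβ hν hμ) (fun x => ?_) rfl
  rw [multiR_toReal hβ, multiR_toReal hβ]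
  ring

instance (n : ℕ) : Finite {k : Fin d → ℕ // ∑ i, k i < n} := by
  refine Set.Finite.to_subtype (s := {k : Fin d → ℕ | ∑ i, k i < n})
    ((Set.Finite.pi' fun _ => Set.finite_lt_nat n).subset fun k hk i => ?_)
  exact (single_le_sum (fun _ _ => Nat.zero_le _) (mem_univ i)).trans_lt hk

theorem linearIndependent_polyR {σ : Fin d → ℝ} {β γ : ℝ} (hσ : ∀ i, -1 < σ i) (hβ : -1 < β)
    {n : ℕ} (hn : 2 * (n : ℝ) < γ - total σ - β - d) :
    LinearIndependent ℝ fun k : {k : Fin d → ℕ // ∑ i, k i < n} => polyR σ β γ k.1 := by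
  have hlt (k : {k : Fin d → ℕ // ∑ i, k i < n}) :
      2 * ((∑ i, k.1 i : ℕ) : ℝ) < γ - total σ - β - d := by
    have : ((∑ i, k.1 i : ℕ) : ℝ) ≤ n := by exact_mod_cast k.2.le
    linarith
  rw [linearIndependent_iff']
  intro s c hc k hk
  have h1 := hasSum_sum (s := s) fun m _ => (hasSum_polyR_mul hσ hβ (hlt m) (hlt k)).mul_left (c m)
  have h2 : ∑ m ∈ s, c m * (if m.1 = k.1 then normA σ β γ m.1 else 0) = c k * normA σ β γ k.1 := by
    rw [sum_eq_single_of_mem k hk]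
    · simp
    · intro m _ hm
      rw [if_neg fun h => hm (Subtype.ext h), mul_zero]
  rw [h2] at h1
  have h3 := h1.unique (hasSum_of_eq hasSum_zero (fun x => ?_) rfl)
  · have := (normA_pos hσ hβ (ν := k.1) (by rw [total_toReal]; exact hlt k)).ne'
    exact (mul_eq_zero.1 h3).resolve_right this
  · have h4 := congrFun hc (toReal x)
    simp only [Finset.sum_apply, Pi.smul_apply, smul_eq_mul, Pi.zero_apply] at h4
    calc _ = weight σ β γ x * polyR σ β γ k.1 (toReal x) *
          ∑ m ∈ s, c m * polyR σ β γ m.1 (toReal x) := by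
          rw [mul_sum]; exact sum_congr rfl fun m _ => by ring
      _ = 0 := by rw [h4, mul_zero]

theorem polyR_mem_polyLT (σ : Fin d → ℝ) (β γ : ℝ) {ν : Fin d → ℕ} {n : ℕ} (h : ∑ i, ν i < n) :
    polyR σ β γ ν ∈ polyLT d n :=
  polyLT_mono h (isPolyLE_polyR σ β γ ν).mem_polyLT

/-- Dimension count: the independent `polyR` lie in a space spanned by falling products with the
same index set. -/
theorem span_polyR {σ : Fin d → ℝ} {β γ : ℝ} (hσ : ∀ i, -1 < σ i) (hβ : -1 < β)
    {n : ℕ} (hn : 2 * (n : ℝ) < γ - total σ - β - d) :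
    Submodule.span ℝ (Set.range fun k : {k : Fin d → ℕ // ∑ i, k i < n} => polyR σ β γ k.1) =
      polyLT d n := by
  have := Fintype.ofFinite {k : Fin d → ℕ // ∑ i, k i < n}
  have e : polyLT d n =
      Submodule.span ℝ (Set.range fun k : {k : Fin d → ℕ // ∑ i, k i < n} => fallProd k.1) := by
    rw [polyLT]
    congr 1
    ext f
    simp [eq_comm]
  have hfin : FiniteDimensional ℝ (polyLT d n) := by
    rw [e]; exact FiniteDimensional.span_of_finite ℝ (Set.finite_range _)
  refine Submodule.eq_of_le_of_finrank_le ?_ ?_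
  · rw [Submodule.span_le]
    rintro _ ⟨k, rfl⟩
    exact polyR_mem_polyLT σ β γ k.2
  · rw [finrank_span_eq_card (linearIndependent_polyR hσ hβ hn), e]
    exact finrank_range_le_card _

/-- `R_ν` is orthogonal to all polynomials of degree less than `|ν|`. -/
theorem hasSum_polyR_mul_polyLT {σ : Fin d → ℝ} {β γ : ℝ} (hσ : ∀ i, -1 < σ i) (hβ : -1 < β)
    {ν : Fin d → ℕ} (hν : 2 * ((∑ i, ν i : ℕ) : ℝ) < γ - total σ - β - d)
    {g : (Fin d → ℝ) → ℝ} (hg : g ∈ polyLT d (∑ i, ν i)) :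
    HasSum (fun x : Fin d → ℕ => weight σ β γ x *
        (polyR σ β γ ν (toReal x) * g (toReal x))) 0 := by
  rw [← span_polyR hσ hβ hν] at hg
  induction hg using Submodule.span_induction with
  | mem g hg =>
    obtain ⟨⟨k, hk⟩, rfl⟩ := hg
    have hk' : ((∑ i, k i : ℕ) : ℝ) ≤ (∑ i, ν i : ℕ) := by exact_mod_cast hk.le
    have := hasSum_polyR_mul hσ hβ hν (μ := k) (by linarith)
    rwa [if_neg (by rintro rfl; exact lt_irrefl _ hk)] at this
  | zero => simp [hasSum_zero]
  | add g h _ _ hg hh => simpa [mul_add] using hg.add hh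
  | smul c g _ hg =>
    refine hasSum_of_eq (hg.mul_left c) (fun x => ?_) (by simp)
    simp only [Pi.smul_apply, smul_eq_mul]; ring

theorem polyR_not_mem_polyLT {σ : Fin d → ℝ} {β γ : ℝ} (hσ : ∀ i, -1 < σ i) (hβ : -1 < β)
    {ν : Fin d → ℕ} (hν : 2 * ((∑ i, ν i : ℕ) : ℝ) < γ - total σ - β - d) :
    polyR σ β γ ν ∉ polyLT d (∑ i, ν i) := by
  intro h
  have h1 := hasSum_polyR_mul hσ hβ hν hν
  rw [if_pos rfl] at h1
  have h2 := (hasSum_polyR_mul_polyLT hσ hβ hν h).unique h1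
  exact (normA_pos hσ hβ (ν := ν) (by rwa [total_toReal])).ne h2

theorem diffOp_mem_polyLT (σ : Fin d → ℝ) (β γ : ℝ) {n : ℕ} {f : (Fin d → ℝ) → ℝ}
    (hf : f ∈ polyLT d (n + 1)) : diffOp σ β γ f ∈ polyLT d (n + 1) := by
  have := Submodule.add_mem _ (polyLT_mono (Nat.le_succ n) (diffOp_sub_mem_polyLT σ β γ hf))
    (Submodule.smul_mem _ (eigenvalue σ β γ n) hf)
  simpa using this

/-- `R_ν` is an eigenfunction of `diffOp`. -/
theorem diffOp_polyR {σ : Fin d → ℝ} {β γ : ℝ} (hσ : ∀ i, -1 < σ i) (hβ : -1 < β)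
    {ν : Fin d → ℕ} (hν : 2 * ((∑ i, ν i : ℕ) : ℝ) < γ - total σ - β - d - 1) :
    diffOp σ β γ (polyR σ β γ ν) = eigenvalue σ β γ (∑ i, ν i) • polyR σ β γ ν := by
  have hmem := diffOp_sub_mem_polyLT σ β γ (isPolyLE_polyR σ β γ ν).mem_polyLT
  rw [← sub_eq_zero]
  set r := diffOp σ β γ (polyR σ β γ ν) - eigenvalue σ β γ (∑ i, ν i) • polyR σ β γ ν with hr
  obtain h0 | ⟨m, hm⟩ : ∑ i, ν i = 0 ∨ ∃ m, ∑ i, ν i = m + 1 := by cases ∑ i, ν i <;> simp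
  · rw [h0] at hmem
    simpa [polyLT] using hmem
  · have hmem' := hmem
    rw [hm] at hmem'
    -- With `|ν| = m + 1` and `r` of degree at most `m`, symmetry requires `2m + 3 = 2|ν| + 1` to
    -- lie below `γ - |σ| - β - d`, which is precisely `hν`.
    have hsym := hasSum_diffOp_symm (γ := γ) hσ hβ (a := m + 1) (b := m) (by
      rw [hm] at hν; push_cast at hν ⊢; linarith) (hm ▸ isPolyLE_polyR σ β γ ν)
      (isPolyLE_of_mem_polyLT hmem')
    have h1 := hasSum_polyR_mul_polyLT hσ hβ (γ := γ) (ν := ν) (by linarith) hmem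
    have h2 := hasSum_polyR_mul_polyLT hσ hβ (γ := γ) (ν := ν) (by linarith)
      (hm ▸ diffOp_mem_polyLT σ β γ hmem' : diffOp σ β γ r ∈ polyLT d (∑ i, ν i))
    -- `⟨r, r⟩ = ⟨D R, r⟩ - λ ⟨R, r⟩`; symmetry moves `D` onto `r`, and `R` is orthogonal to both `D
    -- r` and `r`.
    have h3 : HasSum (fun x : Fin d → ℕ => weight σ β γ x * (r (toReal x) * r (toReal x))) 0 := by
      refine hasSum_of_eq ((hsym.add h2).sub (h1.mul_left (eigenvalue σ β γ (∑ i, ν i))))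
        (fun x => ?_) (by simp)
      have e : r (toReal x) = diffOp σ β γ (polyR σ β γ ν) (toReal x) -
          eigenvalue σ β γ (∑ i, ν i) * polyR σ β γ ν (toReal x) := rfl
      linear_combination weight σ β γ x * r (toReal x) * e
    have hS := total_add_card_nonneg hσ
    have hN : (0 : ℝ) ≤ ((∑ i, ν i : ℕ) : ℝ) := by positivity
    have hw (x : Fin d → ℕ) := weight_pos hσ hβ (show -1 < γ by linarith) x
    refine eq_zero_of_mem_polyLT hmem fun x => ?_
    have h4 := (hasSum_zero_iff_of_nonneg fun x => mul_nonneg (hw x).le (mul_self_nonneg _)).1 h3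
    have h5 := congrFun h4 x
    simpa [(hw x).ne'] using h5

/-- Positivity of the weight forces `β > -1` as soon as `γ` is large. -/
theorem neg_one_lt_of_weight_pos (hd : 0 < d) {σ : Fin d → ℝ} {β γ : ℝ} (hσ : ∀ i, -1 < σ i)
    (hW : ∀ x : Fin d → ℕ, 0 < weight σ β γ x) (h : β + 1 < γ) : -1 < β := by
  by_contra! hβ
  have hratio (n : ℕ) : 0 < poch (β + 1) n / poch (γ + 1) n := by
    have h1 := hW (Pi.single ⟨0, hd⟩ n)
    rw [weight, show ∑ i, (Pi.single ⟨0, hd⟩ n : Fin d → ℕ) i = n by simp] at h1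
    refine (mul_pos_iff_of_pos_left (prod_pos fun i _ => ?_)).1 h1
    exact div_pos (poch_pos (by linarith [hσ i]) _) (by positivity)
  -- The last index with `β + 1 + n ≤ 0`. Since `γ > β + 1`, the denominator `γ + 1 + n` is already
  -- positive, so the next ratio cannot be positive.
  set n := ⌊-(β + 1)⌋₊
  have h1 : (n : ℝ) ≤ -(β + 1) := Nat.floor_le (by linarith)
  have h2 : -(β + 1) < n + 1 := Nat.lt_floor_add_one _
  have h3 := hratio (n + 1)
  rw [poch_succ, poch_succ, mul_div_mul_comm, mul_pos_iff_of_pos_left (hratio n)] at h3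
  have h4 : (β + 1 + n) / (γ + 1 + n) ≤ 0 :=
    div_nonpos_of_nonpos_of_nonneg (by linarith) (by linarith)
  linarith

end Poly

/-- `HasSum` expresses unconditional convergence, which for real series is absolute convergence. -/
theorem theorem5p2 {d : ℕ} (hd : 0 < d) (σ : Fin d → ℝ) (β γ : ℝ)
    (hσ : ∀ i, -1 < σ i) (hW : ∀ x : Fin d → ℕ, 0 < weight σ β γ x) :
    -- polynomial eigenfunctions
    (∀ ν : Fin d → ℕ, 2 * total (toReal ν) < γ - total σ - β - d - 1 →
      ∃ P : MvPolynomial (Fin d) ℝ,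
        P.totalDegree = ∑ i, ν i ∧
        (∀ x : Fin d → ℝ, (∀ i : Fin d, poch (alpha2 β ν x (i.val + 1) + 1) (ν i) ≠ 0) →
          MvPolynomial.eval x P = multiR σ β γ ν x) ∧
        (∀ x : Fin d → ℝ, diffOp σ β γ (fun y => MvPolynomial.eval y P) x =
          eigenvalue σ β γ (∑ i, ν i) * MvPolynomial.eval x P)) ∧
    -- the denominators do not vanish on the lattice, and orthogonality holds there
    (∀ ν : Fin d → ℕ, 2 * total (toReal ν) < γ - total σ - β - d - 1 →
      ∀ (x : Fin d → ℕ) (i : Fin d), poch (alpha2 β ν (toReal x) (i.val + 1) + 1) (ν i) ≠ 0) ∧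
    (∀ ν μ : Fin d → ℕ, 2 * total (toReal ν) < γ - total σ - β - d - 1 →
      2 * total (toReal μ) < γ - total σ - β - d - 1 →
      HasSum (fun x : Fin d → ℕ =>
          multiR σ β γ ν (toReal x) * multiR σ β γ μ (toReal x) * weight σ β γ x)
        (if ν = μ then normA σ β γ ν else 0)) := by
  have hβ {ν : Fin d → ℕ} (hν : 2 * total (toReal ν) < γ - total σ - β - d - 1) : -1 < β := by
    have h1 := total_toReal_nonneg ν
    have h2 := total_add_card_nonneg hσ
    exact neg_one_lt_of_weight_pos hd hσ hW (by linarith)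
  refine ⟨fun ν hν => ?_, fun ν hν x i => (poch_alpha2_pos (hβ hν) ν x _ _).ne',
    fun ν μ hν hμ => hasSum_multiR_mul hσ (hβ hν) (by linarith) (by linarith)⟩
  have hb := hβ hν
  rw [total_toReal] at hν
  obtain ⟨P, hP, hPe⟩ := isPolyLE_polyR σ β γ ν
  refine ⟨P, hP.antisymm (not_lt.1 fun hlt => ?_), fun x hx => ?_, fun x => ?_⟩
  -- A smaller total degree would put `polyR` among the polynomials to which it is orthogonal.
  · refine polyR_not_mem_polyLT hσ hb (γ := γ) (ν := ν) (by linarith) ?_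
    rw [← funext hPe]
    exact polyLT_mono hlt (eval_mem_polyLT le_rfl)
  · rw [hPe, multiR_eq_polyR σ β γ ν x hx]
  · simp only [hPe]
    exact congrFun (diffOp_polyR hσ hb hν) x
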